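/- **Setting.** Let $X$ be a compact complex manifold of dimension $n$ with canonical line bundle $K_X$, let $L:=K_X^*$ be its anticanonical line bundle, and let $p\geq 1$ be an integer such that for every $x\in X$ some holomorphic section of $L^p:=L^{\otimes p}$ does not vanish at $x$. (This holds in particular when $X$ is a Fano manifold and $p$ is so large that the Kodaira map of $L^p$ is well defined and an embedding.) Let $n_p:=\dim H^0(X,L^p)$. For a basis $\mathbf{s}=(s_1,\dots,s_{n_p})$ of $H^0(X,L^p)$, let $H_{\mathbf{s}}$ be the Hermitian inner product on $H^0(X,L^p)$ for which $\mathbf{s}$ is orthonormal. For $x\in X$, let $\Pi_{\mathbf{s}}(x)$ be the $H_{\mathbf{s}}$-orthogonal projector of $H^0(X,L^p)$ with kernel $\{u : u(x)=0\}$. Let $h_{\mathbf{s}}$ be the Hermitian metric on $L$ whose $p$-th tensor power $h_{\mathbf{s}}^p$ is the Fubini–Study metric on $L^p$, defined by $$\langle u(x),v(x)\rangle_{h_{\mathbf{s}}^p}:=\langle \Pi_{\mathbf{s}}(x)u,v\rangle_{H_{\mathbf{s}}}\qquad (u,v\in H^0(X,L^p),\ x\in X),$$ Hermitian products being linear in the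 first variable. Let $d\nu_{\mathbf{s}}$ be the anticanonical volume form of $h_{\mathbf{s}}$, given locally by $d\nu_{\mathbf{s}}:=\sqrt{-1}^{\,n^2}\,\theta\wedge\bar\theta\,/\,|\theta|^2_{h_{\mathbf{s}}^{-1}}$ for any non-vanishing local section $\theta$ of $K_X$, where $h_{\mathbf{s}}^{-1}$ is the metric on $K_X=L^*$ dual to $h_{\mathbf{s}}$, and let $\mathrm{Vol}(d\nu_{\mathbf{s}}):=\int_X d\nu_{\mathbf{s}}$. The moment map is $$\mu_\nu(\mathbf{s}):=\left(\int_X\langle s_j(x),s_k(x)\rangle_{h^p_{\mathbf{s}}}\,d\nu_{\mathbf{s}}(x)\right)_{j,k=1}^{n_p}-\frac{\mathrm{Vol}(d\nu_{\mathbf{s}})}{n_p}\,\mathrm{Id}\ \in\ \mathrm{Herm}(\mathbb{C}^{n_p}),$$ where $\mathrm{Herm}(\mathbb{C}^{n_p})$ is the space of Hermitian $n_p\times n_p$ matrices. A matrix $G\in \mathrm{GL}(\mathbb{C}^{n_p})$ acts on bases by $G\mathbf{s}:=\big(\sum_k G_{jk}s_k\big)_{j}$. For $A\in\mathrm{Herm}(\mathbb{C}^{n_p})$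 set $$D_{\mathbf{s}}\mu_\nu(A):=\frac{d}{dt}\Big|_{t=0}\mu_\nu(e^{tA}\mathbf{s}),\qquad \|A\|_{tr}:=\sqrt{\mathrm{Tr}[AA^*]}.$$ **Proposition.** Let $\mathbf{s}$ be a basis of $H^0(X,L^p)$ and let $\lambda,\delta>0$ be such that 1. $\lambda\,\|\mu_\nu(\mathbf{s})\|_{tr}<\delta$; 2. $\lambda\,\mathrm{Tr}[A\,D_{e^{B}\mathbf{s}}\mu_\nu(A)]\geq\|A\|_{tr}^2$ for all $A\in\mathrm{Herm}(\mathbb{C}^{n_p})$ with $\mathrm{Tr}[A]=0$ and all $B\in\mathrm{Herm}(\mathbb{C}^{n_p})$ with $\|B\|_{tr}\leq\delta$. Then there exists $B\in\mathrm{Herm}(\mathbb{C}^{n_p})$ with $\|B\|_{tr}\leq\delta$ and $\mu_\nu(e^{B}\mathbf{s})=0$. -/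

import Mathlib

open scoped Manifold ContDiff Matrix
open MeasureTheory

namespace Anticanonical

noncomputable section

section Bundle

variable (n : ℕ) (X : Type*) [TopologicalSpace X] [ChartedSpace (Fin n → ℂ) X]
  [IsManifold 𝓘(ℂ, Fin n → ℂ) ω X]

/-- The holomorphic line bundle `L^p`, where `L = K_X^* = det (T^{(1,0)} X)` is the anticanonical
line bundle of the complex manifold `X` of dimension `n`, given by its transition functions.
In a holomorphic chart `z` of the atlas, `L^p` is trivialized by `(∂/∂z₁ ∧ ⋯ ∧ ∂/∂zₙ)^{⊗ p}`, so
that the transition function from a chart `z` to a chart `w` is `det (∂w/∂z) ^ p`, where `∂w/∂z`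
is the corresponding transition function of the holomorphic tangent bundle of `X`. -/
def anticanonicalCore (p : ℕ) : VectorBundleCore ℂ X ℂ (atlas (Fin n → ℂ) X) where
  baseSet i := i.1.source
  isOpen_baseSet i := i.1.open_source
  indexAt := achart (Fin n → ℂ)
  mem_baseSet_at := mem_chart_source (Fin n → ℂ)
  coordChange i j x :=
    (((tangentBundleCore 𝓘(ℂ, Fin n → ℂ) X).coordChange i j x).det ^ p) •
      ContinuousLinearMap.id ℂ ℂ
  coordChange_self i x hx v := by
    have h : (tangentBundleCore 𝓘(ℂ, Fin n → ℂ) X).coordChange i i x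
        = ContinuousLinearMap.id ℂ (Fin n → ℂ) := by
      ext1 w
      exact (tangentBundleCore 𝓘(ℂ, Fin n → ℂ) X).coordChange_self i x hx w
    rw [h]
    simp [ContinuousLinearMap.det]
  continuousOn_coordChange i j :=
    ((ContinuousLinearMap.continuous_det.comp_continuousOn
      ((tangentBundleCore 𝓘(ℂ, Fin n → ℂ) X).continuousOn_coordChange i j)).pow p).smul
        continuousOn_const
  coordChange_comp i j k x hx v := by
    have h : (tangentBundleCore 𝓘(ℂ, Fin n → ℂ) X).coordChange i k x
        = ((tangentBundleCore 𝓘(ℂ, Fin n → ℂ) X).coordChange j k x).comp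
          ((tangentBundleCore 𝓘(ℂ, Fin n → ℂ) X).coordChange i j x) := by
      ext1 w
      exact ((tangentBundleCore 𝓘(ℂ, Fin n → ℂ) X).coordChange_comp i j k x hx w).symm
    rw [h]
    simp only [ContinuousLinearMap.det, ContinuousLinearMap.toLinearMap_comp, LinearMap.det_comp,
      smul_apply, ContinuousLinearMap.id_apply, smul_eq_mul]
    ring

/-- The fibre `L^p_x`. As for the tangent bundle in Mathlib, it is a copy of `ℂ` through the frame
given by the preferred chart at `x`. -/
abbrev Fiber (p : ℕ) (x : X) : Type := (anticanonicalCore n X p).Fiber x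

/-- The space `H^0(X, L^p)` of holomorphic sections of `L^p`. -/
abbrev H0 (p : ℕ) : Type _ :=
  ContMDiffSection 𝓘(ℂ, Fin n → ℂ) ℂ ω (Fiber n X p)

variable {n X}

/-- The local frame `∂/∂z₁ ∧ ⋯ ∧ ∂/∂zₙ` of `L` in a chart `z` of the atlas. -/
def frame (i : atlas (Fin n → ℂ) X) (x : X) : Fiber n X 1 x :=
  (anticanonicalCore n X 1).coordChange i ((anticanonicalCore n X 1).indexAt x) x (1 : ℂ)

/-- The `p`-th tensor power `ξ ↦ ξ^{⊗ p}` from `L_x` to `L^p_x` (both fibres are read in the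
frames given by the same preferred chart at `x`). -/
def tensorPow (p : ℕ) (x : X) (ξ : Fiber n X 1 x) : Fiber n X p x :=
  ((show ℂ from ξ) ^ p : ℂ)

end Bundle

variable {n : ℕ} {X : Type*} [TopologicalSpace X] [ChartedSpace (Fin n → ℂ) X]
  [IsManifold 𝓘(ℂ, Fin n → ℂ) ω X] {p N : ℕ}

/-! In the following definitions, `s = (s₁, …, s_N)` is meant to be a basis of `H^0(X, L^p)`, and
`H_s` is the Hermitian inner product on `H^0(X, L^p)` for which `s` is orthonormal. Through
`v ↦ ∑ v_j s_j`, the Hermitian space `(H^0(X, L^p), H_s)` is the standard Hermitian space `ℂ^N`. -/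

/-- The evaluation map `H^0(X, L^p) → L^p_x`, where `H^0(X, L^p)` is identified with `ℂ^N` by
the basis `s`. -/
def evalMap (s : Fin N → H0 n X p) (x : X) :
    EuclideanSpace ℂ (Fin N) →ₗ[ℂ] Fiber n X p x :=
  (Fintype.linearCombination ℂ (fun j => s j x)) ∘ₗ
    (WithLp.linearEquiv 2 ℂ (Fin N → ℂ)).toLinearMap

/-- The coherent state projector `Π_{H_s}(x)`: the orthogonal projector for `H_s` whose kernel is
the space of sections that vanish at `x`. -/
def coherentProj (s : Fin N → H0 n X p) (x : X) :
    EuclideanSpace ℂ (Fin N) →L[ℂ] EuclideanSpace ℂ (Fin N) :=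
  (LinearMap.ker (evalMap s x))ᗮ.starProjection

/-- The Fubini-Study metric `h_s^p = FS(H_s)` on `L^p`, linear in the first variable, determined by
`⟨u(x), v(x)⟩_{FS(H_s)} = ⟨Π_{H_s}(x) u, v⟩_{H_s}` for all holomorphic sections `u`, `v`
(see `fsInner_evalMap`). -/
def fsInner (s : Fin N → H0 n X p) (x : X) (ξ η : Fiber n X p x) : ℂ :=
  inner ℂ (Function.invFun (evalMap s x) η)
    (coherentProj s x (Function.invFun (evalMap s x) ξ))

theorem fsInner_evalMap (s : Fin N → H0 n X p) (x : X) (u v : EuclideanSpace ℂ (Fin N)) :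
    fsInner s x (evalMap s x u) (evalMap s x v) = inner ℂ v (coherentProj s x u) := by
  have key : ∀ w : EuclideanSpace ℂ (Fin N),
      coherentProj s x (Function.invFun (evalMap s x) (evalMap s x w)) = coherentProj s x w := by
    intro w
    rw [← sub_eq_zero, ← map_sub]
    refine (Submodule.starProjection_apply_eq_zero_iff _).2 ?_
    rw [Submodule.orthogonal_orthogonal, LinearMap.mem_ker, map_sub,
      Function.invFun_eq (f := evalMap s x) ⟨w, rfl⟩, sub_self]
  have symm : ∀ a b : EuclideanSpace ℂ (Fin N),
      inner ℂ a (coherentProj s x b) = inner ℂ (coherentProj s x a) b := fun a b =>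
    (Submodule.inner_starProjection_left_eq_right _ a b).symm
  rw [fsInner, key, symm, key, ← symm]

/-- The squared norm `|ξ|²_{h_s}` of `ξ ∈ L_x`, where `h_s` is the Hermitian metric on `L` whose
`p`-th tensor power is the metric `h_s^p = FS(H_s)` on `L^p`. -/
def normSqL (s : Fin N → H0 n X p) (x : X) (ξ : Fiber n X 1 x) : ℝ :=
  (fsInner s x (tensorPow p x ξ) (tensorPow p x ξ)).re ^ ((1 : ℝ) / p)

/-- The squared norm `|θ|²_{h_s⁻¹}` at `x` of the local section `θ = dz₁ ∧ ⋯ ∧ dzₙ` of `K_X` in a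
chart `z`, for the metric `h_s⁻¹` on `K_X = L^*` dual to `h_s`. As `θ` is the frame dual to
`∂/∂z₁ ∧ ⋯ ∧ ∂/∂zₙ`, it is the inverse of the squared norm of the latter. -/
def normSqTheta (s : Fin N → H0 n X p) (i : atlas (Fin n → ℂ) X) (x : X) : ℝ :=
  (normSqL s x (frame i x))⁻¹

variable [MeasurableSpace X]

/-- The anticanonical volume form `dν_{h_s} = √-1^{n²} θ ∧ θ̄ / |θ|²_{h_s⁻¹}` on the domain of
a chart `z`, as a measure on `X` carried by this domain. We use `θ = dz₁ ∧ ⋯ ∧ dzₙ`, for which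
`√-1^{n²} θ ∧ θ̄ = ∏ √-1 dz_j ∧ dz̄_j` is `2^n` times the Lebesgue measure of `ℂ^n`. -/
def chartVolume (s : Fin N → H0 n X p) (i : atlas (Fin n → ℂ) X) : Measure X :=
  (((volume : Measure (Fin n → ℂ)).restrict i.1.target).withDensity
    fun z => ENNReal.ofReal (2 ^ n / normSqTheta s i (i.1.symm z))).map i.1.symm

/-- The anticanonical volume form `dν_{h_s}` as a measure on `X`: the measure whose restriction
to the domain of every chart is the previous one. These local measures agree on overlaps, so the
measure glued from them is their supremum in the lattice of measures on `X`. -/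
def volumeForm (s : Fin N → H0 n X p) : Measure X :=
  ⨆ i : atlas (Fin n → ℂ) X, chartVolume s i

/-- The moment map
`μ_ν(s) = (∫_X ⟨s_j, s_k⟩_{h_s^p} dν_{h_s})_{j,k} - (Vol(dν_{h_s}) / N) Id`. -/
def momentMap (s : Fin N → H0 n X p) : Matrix (Fin N) (Fin N) ℂ :=
  Matrix.of (fun j k => ∫ x, fsInner s x (s j x) (s k x) ∂(volumeForm s)) -
    (((volumeForm s).real Set.univ / N : ℝ) : ℂ) • (1 : Matrix (Fin N) (Fin N) ℂ)

/-- The action `G s = (∑ₖ G_{jk} s_k)_j` of matrices on `N`-tuples of sections. -/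
def act (G : Matrix (Fin N) (Fin N) ℂ) (s : Fin N → H0 n X p) : Fin N → H0 n X p :=
  fun j => ∑ k, G j k • s k

/-- The derivative `D_s μ_ν(A) = d/dt|_{t=0} μ_ν(e^{tA} s)`, entry by entry. -/
def dMomentMap (s : Fin N → H0 n X p) (A : Matrix (Fin N) (Fin N) ℂ) :
    Matrix (Fin N) (Fin N) ℂ :=
  Matrix.of fun j k =>
    deriv (fun t : ℝ => momentMap (act (NormedSpace.exp ((t : ℂ) • A)) s) j k) 0

/-- The norm `‖A‖_tr = √(Tr[A A^*])` of the Hermitian product `⟨A, B⟩_tr = Tr[A B^*]`. -/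
def trNorm (A : Matrix (Fin N) (Fin N) ℂ) : ℝ :=
  Real.sqrt (A * Aᴴ).trace.re

end

end Anticanonical

open Anticanonical

/-! ### The trace norm of matrices. -/

namespace Anticanonical

/-! Write `m G` for the moment map at `G s`, with `G` invertible. The zero is found by minimization,
with no gradient flow. Fix `c > lam` with `c * trNorm (m 1) < δ` and minimize `c * trNorm (m (exp
B)) + trNorm B` over the compact ball of Hermitian `B` with `trNorm B ≤ δ`. Comparison with `B = 0`
puts a minimizer strictly inside the ball. If `m (exp B) ≠ 0`, move along `exp (t A) * exp B` with
`A = -m (exp B)`: by the lower bound on the derivative, the first term decreases at rate at least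
`(c / lam) * trNorm A`, which exceeds `trNorm A`. This contradicts minimality, provided that `trNorm
B` grows at rate at most `trNorm A`.

That proviso is a form of nonpositive curvature of the positive definite matrices. The polar
decomposition `exp (t A) * exp B = U * exp C` returns the path to Hermitian exponents; dropping `U`
is harmless since `m (U G) = U (m G) U^*` has the same norm. The estimate on `C - B` in
`exists_polar_exp_mul_exp` comes from a trace inequality that reduces, in two eigenbases, to `x ^ 2
≤ exp x + exp (-x) - 2`. The argument is assembled in `exists_zero_of_derivative_ge`.

It remains to verify equivariance, continuity and differentiability of `m`. If `P x` is the matrix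
of Fubini–Study products of `s` and `Q = G (P x) G^*`, passing to `G s` replaces `P` by `Q / Tr Q`
and multiplies the volume form by `(Tr Q) ^ (-1/p)`. Hence `m G` is the traceless part of the
integral of `(Tr Q) ^ (-1/p - 1) Q` against a fixed finite measure (`momentMap_act`), and all three
properties can be read off this formula on the compact `X`. -/

theorem trNorm_nonneg {N : ℕ} (A : Matrix (Fin N) (Fin N) ℂ) : 0 ≤ trNorm A :=
  Real.sqrt_nonneg _

theorem trNorm_sq {N : ℕ} (A : Matrix (Fin N) (Fin N) ℂ) :
    trNorm A ^ 2 = (A * Aᴴ).trace.re := by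
  refine Real.sq_sqrt ?_
  rw [Matrix.trace, Complex.re_sum]
  refine Finset.sum_nonneg fun i _ => ?_
  rw [Matrix.diag_apply, Matrix.mul_apply, Complex.re_sum]
  refine Finset.sum_nonneg fun j _ => ?_
  rw [Matrix.conjTranspose_apply, Complex.star_def, Complex.mul_conj, Complex.ofReal_re]
  exact Complex.normSq_nonneg _

section Frobenius
open scoped Matrix.Norms.Frobenius

/-- Gives access to the triangle inequality and definiteness of the Frobenius norm, whose instance
is only scoped. -/
theorem trNorm_eq_norm {N : ℕ} (A : Matrix (Fin N) (Fin N) ℂ) : trNorm A = ‖A‖ := by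
  rw [trNorm, Matrix.frobenius_norm_def, Real.sqrt_eq_rpow]
  congr 1
  rw [Matrix.trace, Complex.re_sum]
  refine Finset.sum_congr rfl fun i _ => ?_
  rw [Matrix.diag_apply, Matrix.mul_apply, Complex.re_sum]
  refine Finset.sum_congr rfl fun j _ => ?_
  rw [Matrix.conjTranspose_apply, Complex.star_def, Complex.mul_conj, Complex.ofReal_re,
    Complex.normSq_eq_norm_sq, Real.rpow_two]

end Frobenius

/-! ### Exponentials of Hermitian matrices and the polar decomposition. -/

section HermitianExp
open scoped ComplexOrder

variable {N : ℕ}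

theorem exists_unitary_diagonal {B : Matrix (Fin N) (Fin N) ℂ} (hB : B.IsHermitian) :
    ∃ V ∈ Matrix.unitaryGroup (Fin N) ℂ, ∃ b : Fin N → ℝ,
      B = V * Matrix.diagonal (fun i => (b i : ℂ)) * Vᴴ := by
  refine ⟨hB.eigenvectorUnitary, hB.eigenvectorUnitary.2, hB.eigenvalues, ?_⟩
  conv_lhs => rw [hB.spectral_theorem]
  rfl

theorem conjTranspose_mul_self_of_unitary {V : Matrix (Fin N) (Fin N) ℂ}
    (hV : V ∈ Matrix.unitaryGroup (Fin N) ℂ) : Vᴴ * V = 1 :=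
  Matrix.mem_unitaryGroup_iff'.1 hV

theorem self_mul_conjTranspose_of_unitary {V : Matrix (Fin N) (Fin N) ℂ}
    (hV : V ∈ Matrix.unitaryGroup (Fin N) ℂ) : V * Vᴴ = 1 :=
  Matrix.mem_unitaryGroup_iff.1 hV

theorem isHermitian_unitary_diagonal (V : Matrix (Fin N) (Fin N) ℂ) (b : Fin N → ℝ) :
    (V * Matrix.diagonal (fun i => (b i : ℂ)) * Vᴴ).IsHermitian := by
  refine Matrix.isHermitian_mul_mul_conjTranspose V ?_
  rw [Matrix.isHermitian_diagonal_iff]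
  intro i
  exact Complex.conj_ofReal _

theorem exp_unitary_diagonal {V : Matrix (Fin N) (Fin N) ℂ}
    (hV : V ∈ Matrix.unitaryGroup (Fin N) ℂ) (b : Fin N → ℝ) :
    NormedSpace.exp (V * Matrix.diagonal (fun i => (b i : ℂ)) * Vᴴ) =
      V * Matrix.diagonal (fun i => (Real.exp (b i) : ℂ)) * Vᴴ := by
  have hinv : Vᴴ = V⁻¹ := (Matrix.inv_eq_left_inv (conjTranspose_mul_self_of_unitary hV)).symm
  have hu : IsUnit V := IsUnit.of_mul_eq_one _ (self_mul_conjTranspose_of_unitary hV)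
  rw [hinv, Matrix.exp_conj _ _ hu, Matrix.exp_diagonal]
  congr 3
  ext i
  rw [Pi.coe_exp, ← Complex.exp_eq_exp_ℂ, Complex.ofReal_exp]

theorem exp_neg_unitary_diagonal {V : Matrix (Fin N) (Fin N) ℂ}
    (hV : V ∈ Matrix.unitaryGroup (Fin N) ℂ) (b : Fin N → ℝ) :
    NormedSpace.exp (-(V * Matrix.diagonal (fun i => (b i : ℂ)) * Vᴴ)) =
      V * Matrix.diagonal (fun i => (Real.exp (-b i) : ℂ)) * Vᴴ := by
  rw [← exp_unitary_diagonal hV fun i => -b i]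
  congr 1
  have : (Matrix.diagonal fun i => ((-b i : ℝ) : ℂ)) = -Matrix.diagonal fun i => (b i : ℂ) := by
    ext i j
    by_cases h : i = j <;> simp [Matrix.diagonal, h]
  rw [this, Matrix.mul_neg, Matrix.neg_mul]

/-- The weights are nonnegative and do not depend on `f` and `g`, so trace inequalities between two
noncommuting Hermitian matrices reduce to scalar inequalities for pairs of eigenvalues. -/
theorem trace_unitary_diagonal_mul (V W : Matrix (Fin N) (Fin N) ℂ) (f g : Fin N → ℝ) :
    ((V * Matrix.diagonal (fun i => (f i : ℂ)) * Vᴴ) *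
      (W * Matrix.diagonal (fun i => (g i : ℂ)) * Wᴴ)).trace.re =
      ∑ i, ∑ j, Complex.normSq ((Vᴴ * W) i j) * (f i * g j) := by
  have h : ((V * Matrix.diagonal (fun i => (f i : ℂ)) * Vᴴ) *
      (W * Matrix.diagonal (fun i => (g i : ℂ)) * Wᴴ)).trace =
      ((Matrix.diagonal (fun i => (f i : ℂ)) * (Vᴴ * W)) *
        (Matrix.diagonal (fun i => (g i : ℂ)) * (Vᴴ * W)ᴴ)).trace := by
    rw [Matrix.conjTranspose_mul, Matrix.conjTranspose_conjTranspose]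
    simp only [Matrix.mul_assoc]
    rw [Matrix.trace_mul_comm]
    simp only [Matrix.mul_assoc]
  rw [h, Matrix.trace, Complex.re_sum]
  refine Finset.sum_congr rfl fun i _ => ?_
  rw [Matrix.diag_apply, Matrix.mul_apply, Complex.re_sum]
  refine Finset.sum_congr rfl fun j _ => ?_
  rw [Matrix.diagonal_mul, Matrix.diagonal_mul, Matrix.conjTranspose_apply, Complex.star_def]
  have : (f i : ℂ) * (Vᴴ * W) i j * (g j * (starRingEnd ℂ) ((Vᴴ * W) i j)) =
      ((Complex.normSq ((Vᴴ * W) i j) * (f i * g j) : ℝ) : ℂ) := by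
    push_cast
    rw [← Complex.mul_conj]
    ring
  rw [this, Complex.ofReal_re]

/-- The right side is `4 * sinh (x / 2) ^ 2`, and `|u| ≤ |sinh u|`. -/
theorem sq_le_exp_add_exp_neg (x : ℝ) : x ^ 2 ≤ Real.exp x + Real.exp (-x) - 2 := by
  have h : Real.exp x + Real.exp (-x) - 2 = 4 * Real.sinh (x / 2) ^ 2 := by
    have h1 : Real.exp x = Real.exp (x / 2) ^ 2 := by rw [← Real.exp_nat_mul]; congr 1; push_cast; ring
    have h2 : Real.exp (-x) = Real.exp (-(x / 2)) ^ 2 := by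
      rw [← Real.exp_nat_mul]; congr 1; push_cast; ring
    have h3 : Real.exp (x / 2) * Real.exp (-(x / 2)) = 1 := by rw [← Real.exp_add]; simp
    rw [Real.sinh_eq, h1, h2]
    linear_combination 2 * h3
  have h2 : (x / 2) ^ 2 ≤ Real.sinh (x / 2) ^ 2 := by
    rw [sq_le_sq, Real.abs_sinh]
    exact Real.self_le_sinh_iff.2 (abs_nonneg _)
  rw [h]
  linarith

/-- Combines `cosh x ≤ exp (x ^ 2 / 2)` with the second-order bound for `exp` on `[-1, 1]`. It is
used with `x` an eigenvalue of `2A` and `y = trNorm A ^ 2`. -/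
theorem exp_add_exp_neg_le {x y : ℝ} (hx : x ^ 2 ≤ 4 * y ) (hy : 2 * y ≤ 1) :
    Real.exp x + Real.exp (-x) - 2 ≤ x ^ 2 * (1 + 2 * y) := by
  have h1 : Real.exp x + Real.exp (-x) = 2 * Real.cosh x := by rw [Real.cosh_eq]; ring
  have h2 := Real.cosh_le_exp_half_sq x
  have h3 : |x ^ 2 / 2| ≤ 1 := by rw [abs_of_nonneg (by positivity)]; linarith
  have h4 := (abs_le.1 (Real.abs_exp_sub_one_sub_id_le h3)).2
  nlinarith [sq_nonneg x]

theorem trNorm_sq_of_isHermitian {A : Matrix (Fin N) (Fin N) ℂ} (hA : A.IsHermitian) :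
    trNorm A ^ 2 = (A * A).trace.re := by
  rw [trNorm_sq, hA.eq]

/-- The exponential map of the space of positive definite Hermitian matrices does not decrease
distances to first order, in integrated form. -/
theorem trNorm_sub_sq_le {B C : Matrix (Fin N) (Fin N) ℂ} (hB : B.IsHermitian)
    (hC : C.IsHermitian) :
    trNorm (C - B) ^ 2 ≤ (NormedSpace.exp B * NormedSpace.exp (-C)).trace.re +
      (NormedSpace.exp (-B) * NormedSpace.exp C).trace.re - 2 * N := by
  rw [trNorm_sq_of_isHermitian (hC.sub hB)]
  obtain ⟨V, hV, b, rfl⟩ := exists_unitary_diagonal hB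
  obtain ⟨W, hW, c, rfl⟩ := exists_unitary_diagonal hC
  have one_diag : (Matrix.diagonal fun _ : Fin N => ((1 : ℝ) : ℂ)) = 1 := by simp
  have sq (V : Matrix (Fin N) (Fin N) ℂ) (hV : V ∈ Matrix.unitaryGroup (Fin N) ℂ)
      (b : Fin N → ℝ) : (V * Matrix.diagonal (fun i => (b i : ℂ)) * Vᴴ) *
        (V * Matrix.diagonal (fun i => (b i : ℂ)) * Vᴴ) =
        V * Matrix.diagonal (fun i => ((b i ^ 2 : ℝ) : ℂ)) * Vᴴ := by
    rw [show ∀ D : Matrix (Fin N) (Fin N) ℂ, V * D * Vᴴ * (V * D * Vᴴ) =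
      V * (D * (Vᴴ * V) * D) * Vᴴ by intro D; simp only [Matrix.mul_assoc],
      conjTranspose_mul_self_of_unitary hV, Matrix.mul_one, Matrix.diagonal_mul_diagonal]
    congr 3
    ext i
    push_cast
    ring
  have hone (V : Matrix (Fin N) (Fin N) ℂ) (hV : V ∈ Matrix.unitaryGroup (Fin N) ℂ) :
      V * (Matrix.diagonal fun _ : Fin N => ((1 : ℝ) : ℂ)) * Vᴴ = 1 := by
    rw [one_diag, Matrix.mul_one, self_mul_conjTranspose_of_unitary hV]
  -- Replacing one or both matrices by the identity writes `Tr B²`, `Tr C²` and `N` with the same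
  -- weights as the mixed traces; the claim can then be checked term by term.
  have hb := trace_unitary_diagonal_mul V W (fun i => b i ^ 2) (fun _ => 1)
  have hc := trace_unitary_diagonal_mul V W (fun _ => 1) (fun i => c i ^ 2)
  have h1 := trace_unitary_diagonal_mul V W (fun _ => 1) (fun _ => 1)
  rw [hone V hV, Matrix.one_mul] at hc
  rw [hone W hW, Matrix.mul_one] at hb
  rw [hone V hV, hone W hW, Matrix.mul_one, Matrix.trace_one, Fintype.card_fin,
    Complex.natCast_re] at h1
  have hbc := trace_unitary_diagonal_mul V W b c
  have expand : ∀ P Q : Matrix (Fin N) (Fin N) ℂ, ((P - Q) * (P - Q)).trace.re =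
      (Q * Q).trace.re + (P * P).trace.re - 2 * (Q * P).trace.re := by
    intro P Q
    rw [Matrix.sub_mul, Matrix.mul_sub, Matrix.mul_sub, Matrix.trace_sub, Matrix.trace_sub,
      Matrix.trace_sub, Matrix.trace_mul_comm P Q]
    simp only [Complex.sub_re]
    ring
  rw [expand, sq V hV, sq W hW, hb, hc, hbc, exp_unitary_diagonal hV, exp_unitary_diagonal hW,
    exp_neg_unitary_diagonal hV, exp_neg_unitary_diagonal hW, trace_unitary_diagonal_mul,
    trace_unitary_diagonal_mul, h1]
  simp only [Finset.mul_sum, ← Finset.sum_add_distrib, ← Finset.sum_sub_distrib]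
  refine Finset.sum_le_sum fun i _ => Finset.sum_le_sum fun j _ => ?_
  -- The term of index `(i, j)` is this scalar inequality times a nonnegative weight.
  have h := sq_le_exp_add_exp_neg (b i - c j)
  rw [← Real.exp_add, ← Real.exp_add]
  rw [show -(b i - c j) = -b i + c j by ring, sub_eq_add_neg (b i) (c j)] at h
  nlinarith [Complex.normSq_nonneg ((Vᴴ * W) i j)]

/-- Sum the scalar bound over the eigenvalues of `A + A`, whose squares add up to `4 * trNorm A ^
2`. -/
theorem trace_exp_add_trace_exp_neg_le {A : Matrix (Fin N) (Fin N) ℂ} (hA : A.IsHermitian)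
    (hsmall : 2 * trNorm A ^ 2 ≤ 1) :
    (NormedSpace.exp (A + A)).trace.re + (NormedSpace.exp (-(A + A))).trace.re - 2 * N ≤
      4 * trNorm A ^ 2 * (1 + 2 * trNorm A ^ 2) := by
  obtain ⟨V, hV, a, ha⟩ := exists_unitary_diagonal (hA.add hA)
  have trdiag (f : Fin N → ℝ) : (V * Matrix.diagonal (fun i => (f i : ℂ)) * Vᴴ).trace.re =
      ∑ i, f i := by
    rw [Matrix.trace_mul_cycle, conjTranspose_mul_self_of_unitary hV, Matrix.one_mul,
      Matrix.trace_diagonal, Complex.re_sum]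
    simp
  have hnorm : 4 * trNorm A ^ 2 = ∑ i, a i ^ 2 := by
    rw [← trdiag, trNorm_sq_of_isHermitian hA]
    have : (V * Matrix.diagonal (fun i => ((a i ^ 2 : ℝ) : ℂ)) * Vᴴ) = (A + A) * (A + A) := by
      rw [ha, show ∀ D : Matrix (Fin N) (Fin N) ℂ, V * D * Vᴴ * (V * D * Vᴴ) =
        V * (D * (Vᴴ * V) * D) * Vᴴ by intro D; simp only [Matrix.mul_assoc],
        conjTranspose_mul_self_of_unitary hV, Matrix.mul_one, Matrix.diagonal_mul_diagonal]
      congr 3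
      ext i
      push_cast
      ring
    rw [this]
    simp only [Matrix.add_mul, Matrix.mul_add, Matrix.trace_add, Complex.add_re]
    ring
  have hle (i : Fin N) : a i ^ 2 ≤ 4 * trNorm A ^ 2 := by
    rw [hnorm]
    exact Finset.single_le_sum (f := fun i => a i ^ 2) (fun i _ => sq_nonneg _)
      (Finset.mem_univ i)
  rw [ha, exp_unitary_diagonal hV, exp_neg_unitary_diagonal hV, trdiag, trdiag]
  have hN : (2 * N : ℝ) = ∑ _i : Fin N, (2 : ℝ) := by simp [mul_comm]
  rw [hN, ← Finset.sum_add_distrib, ← Finset.sum_sub_distrib, hnorm, Finset.sum_mul]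
  exact Finset.sum_le_sum fun i _ => exp_add_exp_neg_le (hle i) hsmall

theorem exp_mul_exp_neg (A : Matrix (Fin N) (Fin N) ℂ) :
    NormedSpace.exp A * NormedSpace.exp (-A) = 1 := by
  rw [← Matrix.exp_add_of_commute _ _ (Commute.refl A).neg_right]
  simp

theorem exp_neg_mul_exp (A : Matrix (Fin N) (Fin N) ℂ) :
    NormedSpace.exp (-A) * NormedSpace.exp A = 1 := by
  simpa using exp_mul_exp_neg (-A)

theorem isUnit_exp (A : Matrix (Fin N) (Fin N) ℂ) : IsUnit (NormedSpace.exp A) :=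
  IsUnit.of_mul_eq_one _ (exp_mul_exp_neg A)

/-- Polar decomposition of `e^A e^B`, with control on its Hermitian part. -/
theorem exists_polar_exp_mul_exp {A B : Matrix (Fin N) (Fin N) ℂ} (hA : A.IsHermitian)
    (hB : B.IsHermitian) (hsmall : 2 * trNorm A ^ 2 ≤ 1) :
    ∃ C : Matrix (Fin N) (Fin N) ℂ, ∃ U ∈ Matrix.unitaryGroup (Fin N) ℂ, C.IsHermitian ∧
      NormedSpace.exp A * NormedSpace.exp B = U * NormedSpace.exp C ∧
      trNorm (C - B) ≤ trNorm A * (1 + trNorm A ^ 2) := by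
  set G := NormedSpace.exp A * NormedSpace.exp B with hG
  have hGu : IsUnit G := (isUnit_exp A).mul (isUnit_exp B)
  have hQ : (Gᴴ * G).PosDef :=
    Matrix.PosDef.conjTranspose_mul_self G (Matrix.mulVec_injective_of_isUnit hGu)
  -- Half the logarithm of the eigenvalues, so that `exp (C + C) = Gᴴ * G`.
  obtain ⟨V, hV, q, hq⟩ : ∃ V ∈ Matrix.unitaryGroup (Fin N) ℂ, ∃ q : Fin N → ℝ,
      Gᴴ * G = V * Matrix.diagonal (fun i => (Real.exp (q i + q i) : ℂ)) * Vᴴ := by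
    refine ⟨hQ.1.eigenvectorUnitary, hQ.1.eigenvectorUnitary.2,
      fun i => Real.log (hQ.1.eigenvalues i) / 2, ?_⟩
    conv_lhs => rw [hQ.1.spectral_theorem]
    simp only [add_halves, Real.exp_log (hQ.eigenvalues_pos _)]
    rfl
  set C := V * Matrix.diagonal (fun i => (q i : ℂ)) * Vᴴ with hCdef
  have hC : C.IsHermitian := isHermitian_unitary_diagonal V q
  have hCC : NormedSpace.exp (C + C) = Gᴴ * G := by
    rw [hq, ← exp_unitary_diagonal hV, hCdef, ← Matrix.add_mul, ← Matrix.mul_add,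
      Matrix.diagonal_add]
    simp
  have hexpH (D : Matrix (Fin N) (Fin N) ℂ) (hD : D.IsHermitian) :
      (NormedSpace.exp D)ᴴ = NormedSpace.exp D := by rw [← Matrix.exp_conjTranspose, hD.eq]
  have dbl (D : Matrix (Fin N) (Fin N) ℂ) :
      NormedSpace.exp (D + D) = NormedSpace.exp D * NormedSpace.exp D :=
    Matrix.exp_add_of_commute _ _ (Commute.refl D)
  have hGG : Gᴴ * G = NormedSpace.exp B * NormedSpace.exp (A + A) * NormedSpace.exp B := by
    rw [hG, Matrix.conjTranspose_mul, hexpH A hA, hexpH B hB, dbl A]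
    simp only [Matrix.mul_assoc]
  refine ⟨C, G * NormedSpace.exp (-C), ?_, hC, ?_, ?_⟩
  · rw [Matrix.mem_unitaryGroup_iff', Matrix.star_eq_conjTranspose, Matrix.conjTranspose_mul,
      hexpH (-C) hC.neg]
    rw [show NormedSpace.exp (-C) * Gᴴ * (G * NormedSpace.exp (-C)) =
      NormedSpace.exp (-C) * (Gᴴ * G) * NormedSpace.exp (-C) by simp only [Matrix.mul_assoc],
      ← hCC, dbl C, ← Matrix.mul_assoc, exp_neg_mul_exp, Matrix.one_mul, exp_mul_exp_neg]
  · rw [Matrix.mul_assoc, exp_neg_mul_exp, Matrix.mul_one]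
  -- The inequality is applied to the doubled exponents because `exp (2C) = exp B * exp (2A) * exp
  -- B` is explicit; by cyclicity both mixed traces then lose `B` and become `Tr (exp (±2A))`.
  · have key := trNorm_sub_sq_le (hB.add hB) (hC.add hC)
    have e1 : (NormedSpace.exp (-(B + B)) * NormedSpace.exp (C + C)).trace =
        (NormedSpace.exp (A + A)).trace := by
      rw [hCC, hGG, neg_add, dbl (-B), Matrix.trace_mul_comm]
      rw [show ∀ P Q R : Matrix (Fin N) (Fin N) ℂ, P * Q * P * (R * R) =
        P * (Q * (P * R) * R) by intros; simp only [Matrix.mul_assoc], exp_mul_exp_neg,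
        Matrix.mul_one, Matrix.trace_mul_comm, Matrix.mul_assoc, exp_neg_mul_exp, Matrix.mul_one]
    have hinv : NormedSpace.exp (-(C + C)) =
        NormedSpace.exp (-B) * NormedSpace.exp (-(A + A)) * NormedSpace.exp (-B) := by
      have h1 : NormedSpace.exp (C + C) *
          (NormedSpace.exp (-B) * NormedSpace.exp (-(A + A)) * NormedSpace.exp (-B)) = 1 := by
        rw [hCC, hGG]
        rw [show ∀ P Q R S : Matrix (Fin N) (Fin N) ℂ, P * Q * P * (R * S * R) =
          P * (Q * (P * R) * S) * R by intros; simp only [Matrix.mul_assoc], exp_mul_exp_neg,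
          Matrix.mul_one, exp_mul_exp_neg, Matrix.mul_one, exp_mul_exp_neg]
      calc _ = NormedSpace.exp (-(C + C)) * (NormedSpace.exp (C + C) *
          (NormedSpace.exp (-B) * NormedSpace.exp (-(A + A)) * NormedSpace.exp (-B))) := by
            rw [h1, Matrix.mul_one]
        _ = _ := by rw [← Matrix.mul_assoc, exp_neg_mul_exp, Matrix.one_mul]
    have e2 : (NormedSpace.exp (B + B) * NormedSpace.exp (-(C + C))).trace =
        (NormedSpace.exp (-(A + A))).trace := by
      rw [hinv, dbl B]
      rw [show ∀ P Q R : Matrix (Fin N) (Fin N) ℂ, P * P * (R * Q * R) =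
        P * ((P * R) * Q * R) by intros; simp only [Matrix.mul_assoc], exp_mul_exp_neg,
        Matrix.one_mul, Matrix.trace_mul_comm, Matrix.mul_assoc, exp_neg_mul_exp, Matrix.mul_one]
    have e3 := trace_exp_add_trace_exp_neg_le hA hsmall
    have e4 : trNorm (C + C - (B + B)) ^ 2 = 4 * trNorm (C - B) ^ 2 := by
      rw [trNorm_sq_of_isHermitian ((hC.add hC).sub (hB.add hB)),
        trNorm_sq_of_isHermitian (hC.sub hB),
        show C + C - (B + B) = (C - B) + (C - B) by abel]
      simp only [Matrix.add_mul, Matrix.mul_add, Matrix.trace_add, Complex.add_re]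
      ring
    rw [e1, e2, e4] at key
    have hA0 : 0 ≤ trNorm A := trNorm_nonneg A
    refine (sq_le_sq₀ (trNorm_nonneg _) (by positivity)).1 ?_
    -- Uses `1 + 2y ≤ (1 + y) ^ 2` with `y = trNorm A ^ 2`.
    nlinarith [sq_nonneg (trNorm A ^ 2), mul_nonneg (sq_nonneg (trNorm A)) (sq_nonneg (trNorm A ^ 2))]

end HermitianExp

/-! ### The variational argument on a ball of Hermitian matrices. -/

section Minimization

variable {N : ℕ}

theorem trNorm_sq_eq_sum (A : Matrix (Fin N) (Fin N) ℂ) :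
    trNorm A ^ 2 = ∑ i, ∑ j, ((A i j).re ^ 2 + (A i j).im ^ 2) := by
  rw [trNorm_sq, Matrix.trace, Complex.re_sum]
  refine Finset.sum_congr rfl fun i _ => ?_
  rw [Matrix.diag_apply, Matrix.mul_apply, Complex.re_sum]
  refine Finset.sum_congr rfl fun j _ => ?_
  rw [Matrix.conjTranspose_apply, Complex.star_def, Complex.mul_conj, Complex.ofReal_re,
    Complex.normSq_apply]
  ring

theorem trace_mul_re_eq_sum {A : Matrix (Fin N) (Fin N) ℂ} (hA : A.IsHermitian)
    (D : Matrix (Fin N) (Fin N) ℂ) :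
    (A * D).trace.re = ∑ i, ∑ j, ((A i j).re * (D i j).re + (A i j).im * (D i j).im) := by
  rw [Matrix.trace, Complex.re_sum, Finset.sum_comm]
  refine Finset.sum_congr rfl fun i _ => ?_
  rw [Matrix.diag_apply, Matrix.mul_apply, Complex.re_sum]
  refine Finset.sum_congr rfl fun j _ => ?_
  rw [← hA.apply i j, Complex.star_def, Complex.mul_re, Complex.conj_re, Complex.conj_im]
  ring

theorem trNorm_unitary_conj {U : Matrix (Fin N) (Fin N) ℂ}
    (hU : U ∈ Matrix.unitaryGroup (Fin N) ℂ) (A : Matrix (Fin N) (Fin N) ℂ) :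
    trNorm (U * A * Uᴴ) = trNorm A := by
  have hU' := conjTranspose_mul_self_of_unitary hU
  rw [trNorm, trNorm]
  congr 2
  rw [Matrix.conjTranspose_mul, Matrix.conjTranspose_mul, Matrix.conjTranspose_conjTranspose]
  rw [show U * A * Uᴴ * (U * (Aᴴ * Uᴴ)) = U * (A * (Uᴴ * U) * Aᴴ) * Uᴴ by
    simp only [Matrix.mul_assoc], hU', Matrix.mul_one, Matrix.trace_mul_comm, ← Matrix.mul_assoc,
    hU', Matrix.one_mul]

theorem continuous_trNorm : Continuous (trNorm (N := N)) := by
  unfold trNorm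
  fun_prop

theorem trNorm_add_le (A B : Matrix (Fin N) (Fin N) ℂ) :
    trNorm (A + B) ≤ trNorm A + trNorm B := by
  simp only [trNorm_eq_norm]
  exact @norm_add_le _ (Matrix.frobeniusSeminormedAddCommGroup).toSeminormedAddGroup A B

theorem trNorm_real_smul {t : ℝ} (ht : 0 ≤ t) (A : Matrix (Fin N) (Fin N) ℂ) :
    trNorm ((t : ℂ) • A) = t * trNorm A := by
  rw [← sq_eq_sq₀ (trNorm_nonneg _) (mul_nonneg ht (trNorm_nonneg _)), mul_pow,
    trNorm_sq_eq_sum, trNorm_sq_eq_sum, Finset.mul_sum]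
  refine Finset.sum_congr rfl fun i _ => ?_
  rw [Finset.mul_sum]
  refine Finset.sum_congr rfl fun j _ => ?_
  simp [Complex.mul_re, Complex.mul_im]
  ring

theorem trNorm_eq_zero_iff {A : Matrix (Fin N) (Fin N) ℂ} : trNorm A = 0 ↔ A = 0 := by
  rw [trNorm_eq_norm]
  let := @Matrix.frobeniusNormedAddCommGroup (Fin N) (Fin N) ℂ _ _ _
  exact norm_eq_zero

theorem isCompact_hermitian_ball (δ : ℝ) :
    IsCompact {B : Matrix (Fin N) (Fin N) ℂ | B.IsHermitian ∧ trNorm B ≤ δ} := by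
  have hclosed : IsClosed {B : Matrix (Fin N) (Fin N) ℂ | B.IsHermitian ∧ trNorm B ≤ δ} :=
    (isClosed_eq (f := fun B : Matrix (Fin N) (Fin N) ℂ => Bᴴ) (g := fun B => B)
      (by fun_prop) continuous_id).inter (isClosed_le continuous_trNorm continuous_const)
  have hcpt : IsCompact (Set.pi Set.univ fun _ : Fin N => Set.pi Set.univ fun _ : Fin N =>
      Metric.closedBall (0 : ℂ) δ) :=
    isCompact_univ_pi fun _ => isCompact_univ_pi fun _ => isCompact_closedBall _ _
  refine IsCompact.of_isClosed_subset hcpt hclosed ?_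
  rintro B ⟨-, hB⟩ i - j -
  rw [mem_closedBall_zero_iff]
  refine le_trans ?_ hB
  rw [← sq_le_sq₀ (norm_nonneg _) (trNorm_nonneg _), trNorm_sq_eq_sum]
  have h1 : ‖B i j‖ ^ 2 = (B i j).re ^ 2 + (B i j).im ^ 2 := by
    rw [← Complex.normSq_eq_norm_sq, Complex.normSq_apply]; ring
  rw [h1]
  refine le_trans ?_ (Finset.single_le_sum (f := fun i => ∑ j, ((B i j).re ^ 2 + (B i j).im ^ 2))
    (fun i _ => Finset.sum_nonneg fun j _ => by positivity) (Finset.mem_univ i))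
  exact Finset.single_le_sum (f := fun j => ((B i j).re ^ 2 + (B i j).im ^ 2))
    (fun j _ => by positivity) (Finset.mem_univ j)

theorem exists_pos_lt_of_hasDerivAt_neg {f : ℝ → ℝ} {f' ε : ℝ} (hf : HasDerivAt f f' 0)
    (hf' : f' < 0) (hε : 0 < ε) : ∃ t, 0 < t ∧ t < ε ∧ f t < f 0 := by
  have h1 : ∀ᶠ t in nhdsWithin (0 : ℝ) (Set.Ioi 0), slope f 0 t < 0 :=
    ((hasDerivAt_iff_tendsto_slope.1 hf).mono_left
      (nhdsWithin_mono _ fun x (hx : 0 < x) => ne_of_gt hx)).eventually (gt_mem_nhds hf')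
  have h2 : ∀ᶠ t in nhdsWithin (0 : ℝ) (Set.Ioi 0), t ∈ Set.Ioo 0 ε :=
    Ioo_mem_nhdsGT hε
  obtain ⟨t, ht, ht0, htε⟩ := (h1.and h2).exists
  refine ⟨t, ht0, htε, ?_⟩
  rw [slope_def_field, sub_zero, div_neg_iff] at ht
  rcases ht with h | h
  · exact absurd h.2 (not_lt.2 ht0.le)
  · linarith [h.1]

/-- A unitarily equivariant map on invertible matrices, whose derivative along the orbits of
one-parameter groups is bounded below on a ball, has a zero in this ball as soon as it is small
enough at the centre. -/
theorem exists_zero_of_derivative_ge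
    {m : Matrix (Fin N) (Fin N) ℂ → Matrix (Fin N) (Fin N) ℂ}
    {D : Matrix (Fin N) (Fin N) ℂ → Matrix (Fin N) (Fin N) ℂ → Matrix (Fin N) (Fin N) ℂ}
    (hU : ∀ U ∈ Matrix.unitaryGroup (Fin N) ℂ, ∀ G, IsUnit G → m (U * G) = U * m G * Uᴴ)
    (hherm : ∀ G, IsUnit G → (m G).IsHermitian) (htr : ∀ G, IsUnit G → (m G).trace = 0)
    (hcont : Continuous fun B => m (NormedSpace.exp B))
    (hderiv : ∀ A G, IsUnit G → ∀ j k,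
      HasDerivAt (fun t : ℝ => m (NormedSpace.exp ((t : ℂ) • A) * G) j k) (D G A j k) 0)
    {lam δ : ℝ} (hlam : 0 < lam) (hδ : 0 < δ) (h1 : lam * trNorm (m 1) < δ)
    (h2 : ∀ A B : Matrix (Fin N) (Fin N) ℂ, A.IsHermitian → A.trace = 0 → B.IsHermitian →
      trNorm B ≤ δ → trNorm A ^ 2 ≤ lam * (A * D (NormedSpace.exp B) A).trace.re) :
    ∃ B : Matrix (Fin N) (Fin N) ℂ, B.IsHermitian ∧ trNorm B ≤ δ ∧ m (NormedSpace.exp B) = 0 := by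
  -- The room between `lam` and `c` turns the non-strict bound on the derivative into a strict
  -- decrease.
  obtain ⟨c, hc, hcδ⟩ : ∃ c, lam < c ∧ c * trNorm (m 1) < δ := by
    have : ∀ᶠ c in nhdsWithin lam (Set.Ioi lam), c * trNorm (m 1) < δ :=
      ((continuous_id.mul continuous_const).tendsto lam).eventually (gt_mem_nhds h1)
        |>.filter_mono nhdsWithin_le_nhds
    obtain ⟨c, h, h'⟩ := (this.and self_mem_nhdsWithin).exists
    exact ⟨c, h', h⟩
  have hc0 : 0 < c := hlam.trans hc
  set Φ : Matrix (Fin N) (Fin N) ℂ → ℝ := fun B => c * trNorm (m (NormedSpace.exp B)) + trNorm B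
    with hΦ
  have hz : trNorm (0 : Matrix (Fin N) (Fin N) ℂ) = 0 := trNorm_eq_zero_iff.2 rfl
  have hΦc : Continuous Φ :=
    (continuous_const.mul (continuous_trNorm.comp hcont)).add continuous_trNorm
  have h0mem : (0 : Matrix (Fin N) (Fin N) ℂ) ∈
      {B : Matrix (Fin N) (Fin N) ℂ | B.IsHermitian ∧ trNorm B ≤ δ} :=
    ⟨Matrix.isHermitian_zero, by rw [hz]; exact hδ.le⟩
  obtain ⟨B, ⟨hB, hBδ⟩, hmin⟩ := (isCompact_hermitian_ball δ).exists_isMinOn ⟨0, h0mem⟩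
    hΦc.continuousOn
  refine ⟨B, hB, hBδ, ?_⟩
  by_contra hne
  -- The value of `Φ` at `0` is already below `δ`, so the minimizer is interior and small moves stay
  -- in the ball.
  have hBlt : trNorm B < δ := by
    have := hmin h0mem
    simp only [hΦ, Set.mem_ofPred_eq, hz, add_zero, NormedSpace.exp_zero] at this
    nlinarith [trNorm_nonneg (m (NormedSpace.exp B))]
  have hBu := isUnit_exp B
  set G := NormedSpace.exp B with hG
  set A := -m G with hA
  have hAh : A.IsHermitian := (hherm G hBu).neg
  set a := trNorm A with ha
  have haG : trNorm (m G) = a := by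
    rw [ha, hA, trNorm, trNorm, Matrix.conjTranspose_neg, Matrix.neg_mul, Matrix.mul_neg, neg_neg]
  have ha0 : 0 < a := lt_of_le_of_ne (trNorm_nonneg _) fun h =>
    hne (trNorm_eq_zero_iff.1 (haG.trans h.symm))
  have hd := h2 A B hAh (by rw [hA, Matrix.trace_neg, htr G hBu, neg_zero]) hB hBδ
  rw [← hG] at hd
  set d := (A * D G A).trace.re with hdd
  set ψ : ℝ → ℝ := fun t => trNorm (m (NormedSpace.exp ((t : ℂ) • A) * G)) with hψ
  have hzero : NormedSpace.exp (((0 : ℝ) : ℂ) • A) * G = G := by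
    rw [Complex.ofReal_zero, zero_smul, NormedSpace.exp_zero, Matrix.one_mul]
  have hψ0 : ψ 0 = a := by rw [hψ]; simp only [hzero, haG]
  -- Differentiate the squared norm as a sum of squares of real and imaginary parts, then take the
  -- root, which is smooth here because `a > 0`. The sign comes from `m G = -A`.
  have hψ' : HasDerivAt ψ (-d / a) 0 := by
    have hsq : HasDerivAt (fun t : ℝ => ∑ i, ∑ j,
        ((m (NormedSpace.exp ((t : ℂ) • A) * G) i j).re ^ 2 +
          (m (NormedSpace.exp ((t : ℂ) • A) * G) i j).im ^ 2)) (-2 * d) 0 := by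
      have e : -2 * d = ∑ i, ∑ j, (2 * (m G i j).re * (D G A i j).re +
          2 * (m G i j).im * (D G A i j).im) := by
        rw [hdd, trace_mul_re_eq_sum hAh, Finset.mul_sum]
        refine Finset.sum_congr rfl fun i _ => ?_
        rw [Finset.mul_sum]
        refine Finset.sum_congr rfl fun j _ => ?_
        simp only [hA, Matrix.neg_apply, Complex.neg_re, Complex.neg_im]
        ring
      rw [e]
      refine HasDerivAt.fun_sum fun i _ => HasDerivAt.fun_sum fun j _ => ?_
      have hj := hderiv A G hBu i j
      have hre : HasDerivAt (fun t : ℝ => (m (NormedSpace.exp ((t : ℂ) • A) * G) i j).re)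
          (D G A i j).re 0 := Complex.reCLM.hasFDerivAt.comp_hasDerivAt 0 hj
      have him : HasDerivAt (fun t : ℝ => (m (NormedSpace.exp ((t : ℂ) • A) * G) i j).im)
          (D G A i j).im 0 := Complex.imCLM.hasFDerivAt.comp_hasDerivAt 0 hj
      have := (hre.fun_pow 2).fun_add (him.fun_pow 2)
      simpa only [hzero, Nat.cast_ofNat, Nat.add_one_sub_one, pow_one] using this
    have hfun : ψ = fun t : ℝ => Real.sqrt (∑ i, ∑ j,
        ((m (NormedSpace.exp ((t : ℂ) • A) * G) i j).re ^ 2 +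
          (m (NormedSpace.exp ((t : ℂ) • A) * G) i j).im ^ 2)) := by
      funext t
      rw [← trNorm_sq_eq_sum, Real.sqrt_sq (trNorm_nonneg _)]
    have hval : Real.sqrt (∑ i, ∑ j,
        ((m (NormedSpace.exp (((0 : ℝ) : ℂ) • A) * G) i j).re ^ 2 +
          (m (NormedSpace.exp (((0 : ℝ) : ℂ) • A) * G) i j).im ^ 2)) = a := by
      rw [← hψ0, hfun]
    have hpos := Real.sqrt_pos.1 (hval ▸ ha0)
    have := hsq.sqrt hpos.ne'
    rw [hval] at this
    rw [hfun]
    convert this using 1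
    field_simp
  -- The second summand is the bound on `trNorm (C - B)` from the polar decomposition, so this
  -- function plus `trNorm B` majorizes `Φ C`. Its cubic correction does not affect the derivative
  -- at `0`.
  have hder : HasDerivAt (fun t : ℝ => c * ψ t + t * a * (1 + (t * a) ^ 2))
      (c * (-d / a) + a) 0 := by
    have e : HasDerivAt (fun t : ℝ => t * a * (1 + (t * a) ^ 2)) a 0 := by
      have h := (hasDerivAt_id' (0 : ℝ)).mul_const a
      have := h.fun_mul ((h.fun_pow 2).const_add 1)
      simpa using this
    exact (hψ'.const_mul c).fun_add e
  have hneg : c * (-d / a) + a < 0 := by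
    -- From `a ^ 2 ≤ lam * d < c * d`.
    have h3 : a < c * (d / a) := by
      rw [← mul_div_assoc, lt_div_iff₀ ha0]
      have hdpos : 0 < d := by
        by_contra hcon
        nlinarith
      nlinarith
    rw [neg_div]
    linarith
  have hsmall : ∃ ε > 0, ∀ t, 0 < t → t < ε → 2 * (t * a) ^ 2 ≤ 1 ∧
      trNorm B + t * a * (1 + (t * a) ^ 2) ≤ δ := by
    have hcts : Continuous fun t : ℝ => trNorm B + t * a * (1 + (t * a) ^ 2) := by fun_prop
    have hcts' : Continuous fun t : ℝ => 2 * (t * a) ^ 2 := by fun_prop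
    have e1 := (hcts.tendsto 0).eventually (eventually_le_nhds (b := δ) (by simpa using hBlt))
    have e2 := (hcts'.tendsto 0).eventually (eventually_le_nhds (b := 1) (by simp))
    obtain ⟨ε, hε, h⟩ := Metric.eventually_nhds_iff.1 (e2.and e1)
    exact ⟨ε, hε, fun t ht htε => h (by rwa [Real.dist_eq, sub_zero, abs_of_pos ht])⟩
  obtain ⟨ε, hε, hεs⟩ := hsmall
  obtain ⟨t, ht0, htε, htlt⟩ := exists_pos_lt_of_hasDerivAt_neg hder hneg hε
  obtain ⟨hs1, hs2⟩ := hεs t ht0 htε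
  have htA : ((t : ℂ) • A).IsHermitian := by
    rw [Matrix.IsHermitian, Matrix.conjTranspose_smul, hAh.eq, Complex.star_def,
      Complex.conj_ofReal]
  have hta : trNorm ((t : ℂ) • A) = t * a := trNorm_real_smul ht0.le A
  -- `C` is the competitor that contradicts the minimality of `B`.
  obtain ⟨C, U, hUU, hC, hpolar, hdist⟩ := exists_polar_exp_mul_exp htA hB (by rwa [hta])
  rw [hta] at hdist
  have hCB : trNorm C ≤ trNorm B + t * a * (1 + (t * a) ^ 2) := by
    have := trNorm_add_le B (C - B)
    rw [add_sub_cancel] at this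
    linarith
  have hfin := hmin (show C ∈ {B : Matrix (Fin N) (Fin N) ℂ | B.IsHermitian ∧ trNorm B ≤ δ} from
    ⟨hC, hCB.trans hs2⟩)
  simp only [hΦ, Set.mem_ofPred_eq] at hfin
  have hψt : ψ t = trNorm (m (NormedSpace.exp C)) := by
    simp only [hψ]
    rw [hG, hpolar, hU U hUU _ (isUnit_exp C), trNorm_unitary_conj hUU]
  rw [← hψt, ← hG, haG] at hfin
  rw [hψ0] at htlt
  simp only [zero_mul, add_zero] at htlt
  linarith

end Minimization

/-! ### The Fubini–Study metric at a point and its change under matrices. -/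

noncomputable section

section PointwiseMetric

variable {n : ℕ} {X : Type*} [TopologicalSpace X] [ChartedSpace (Fin n → ℂ) X]
  [IsManifold 𝓘(ℂ, Fin n → ℂ) ω X] {p N : ℕ}

/-- The complex number by which an element of the fibre is represented in the frame of the
preferred chart. -/
def toComplex (x : X) : Fiber n X p x →ₗ[ℂ] ℂ where
  toFun ξ := ξ
  map_add' _ _ := rfl
  map_smul' _ _ := rfl

theorem toComplex_injective (x : X) : Function.Injective (toComplex (n := n) (p := p) x) :=
  fun _ _ h => h

/-- The squared norm of the vector of the values of `s` at `x`, in the frame of the preferred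
chart. -/
def valueNormSq (s : Fin N → H0 n X p) (x : X) : ℝ :=
  ∑ j, Complex.normSq (toComplex x (s j x))

theorem valueNormSq_pos {s : Fin N → H0 n X p} {x : X} (hs : ∃ j, s j x ≠ 0) :
    0 < valueNormSq s x := by
  obtain ⟨j, hj⟩ := hs
  refine Finset.sum_pos' (fun j _ => Complex.normSq_nonneg _) ⟨j, Finset.mem_univ j, ?_⟩
  rw [Complex.normSq_pos]
  intro h
  exact hj (toComplex_injective x (h.trans (map_zero _).symm))

theorem toComplex_evalMap (s : Fin N → H0 n X p) (x : X) (v : EuclideanSpace ℂ (Fin N)) :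
    toComplex x (evalMap s x v) =
      inner ℂ (WithLp.toLp 2 fun j => star (toComplex x (s j x))) v := by
  simp [evalMap, Fintype.linearCombination_apply, PiLp.inner_apply]

/-- Evaluation at `x` is, in the preferred frame, the pairing with the vector `w` of conjugate
values of `s`. The orthogonal of its kernel contains `w`, which is therefore fixed by the projector,
and multiples of `w` lift every element of the fibre. -/
theorem fsInner_eq {s : Fin N → H0 n X p} {x : X} (hs : ∃ j, s j x ≠ 0) (ξ η : Fiber n X p x) :
    fsInner s x ξ η =
      toComplex x ξ * star (toComplex x η) / (valueNormSq s x : ℂ) := by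
  set w : EuclideanSpace ℂ (Fin N) := WithLp.toLp 2 fun j => star (toComplex x (s j x)) with hw
  have hσ : (valueNormSq s x : ℂ) ≠ 0 := by
    exact_mod_cast (valueNormSq_pos hs).ne'
  have hww : inner ℂ w w = (valueNormSq s x : ℂ) := by
    rw [hw, PiLp.inner_apply, valueNormSq, Complex.ofReal_sum]
    refine Finset.sum_congr rfl fun j _ => ?_
    simp [Complex.normSq_eq_norm_sq]
  have hev (ζ : Fiber n X p x) :
      evalMap s x ((toComplex x ζ / valueNormSq s x) • w) = ζ := by
    apply toComplex_injective x
    rw [toComplex_evalMap, ← hw, inner_smul_right, hww, div_mul_cancel₀ _ hσ]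
  have hmem : w ∈ (LinearMap.ker (evalMap s x))ᗮ := by
    rw [Submodule.mem_orthogonal']
    intro k hk
    rw [hw, ← toComplex_evalMap, LinearMap.mem_ker.1 hk, map_zero]
  have hproj : coherentProj s x w = w :=
    Submodule.starProjection_eq_self_iff.2 hmem
  conv_lhs => rw [← hev ξ, ← hev η]
  rw [fsInner_evalMap, map_smul, hproj, inner_smul_left, inner_smul_right, hww]
  simp only [map_div₀, Complex.conj_ofReal, Complex.star_def]
  field_simp

/-- The component of an element of the fibre in the frame of a chart. -/
def chartComponent (i : atlas (Fin n → ℂ) X) (x : X) (ξ : Fiber n X p x) : ℂ :=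
  (anticanonicalCore n X p).coordChange ((anticanonicalCore n X p).indexAt x) i x ξ

/-- The Jacobian determinant at `x` of the change of charts from `i` to `k`. -/
def jacobian (i k : atlas (Fin n → ℂ) X) (x : X) : ℂ :=
  ((tangentBundleCore 𝓘(ℂ, Fin n → ℂ) X).coordChange i k x).det

theorem coordChange_eq_jacobian (i k : atlas (Fin n → ℂ) X) (x : X) (v : ℂ) :
    (anticanonicalCore n X p).coordChange i k x v = jacobian i k x ^ p * v := by
  simp [anticanonicalCore, jacobian]

theorem chartComponent_eq (i : atlas (Fin n → ℂ) X) (x : X) (ξ : Fiber n X p x) :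
    chartComponent i x ξ = jacobian (achart (Fin n → ℂ) x) i x ^ p * toComplex x ξ :=
  coordChange_eq_jacobian _ _ _ _

theorem jacobian_mul_jacobian (i k l : atlas (Fin n → ℂ) X) {x : X} (hi : x ∈ i.1.source)
    (hk : x ∈ k.1.source) (hl : x ∈ l.1.source) :
    jacobian k l x * jacobian i k x = jacobian i l x := by
  have h := (anticanonicalCore n X 1).coordChange_comp i k l x ⟨⟨hi, hk⟩, hl⟩ 1
  simpa only [coordChange_eq_jacobian, pow_one, mul_one] using h

theorem jacobian_self (i : atlas (Fin n → ℂ) X) {x : X} (hi : x ∈ i.1.source) :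
    jacobian i i x = 1 := by
  have h := (anticanonicalCore n X 1).coordChange_self i x hi 1
  simpa only [coordChange_eq_jacobian, pow_one, mul_one] using h

theorem jacobian_ne_zero (i k : atlas (Fin n → ℂ) X) {x : X} (hi : x ∈ i.1.source)
    (hk : x ∈ k.1.source) : jacobian i k x ≠ 0 := by
  intro h
  have := jacobian_mul_jacobian i k i hi hk hi
  rw [h, mul_zero, jacobian_self i hi] at this
  exact zero_ne_one this

/-- The squared norm of the vector of the components of `s` in the frame of a chart. -/
def chartNormSq (s : Fin N → H0 n X p) (i : atlas (Fin n → ℂ) X) (x : X) : ℝ :=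
  ∑ j, Complex.normSq (chartComponent i x (s j x))

theorem chartNormSq_eq (s : Fin N → H0 n X p) (i : atlas (Fin n → ℂ) X) (x : X) :
    chartNormSq s i x =
      Complex.normSq (jacobian (achart (Fin n → ℂ) x) i x) ^ p * valueNormSq s x := by
  simp only [chartNormSq, chartComponent_eq, map_mul, map_pow, valueNormSq, Finset.mul_sum]

omit [IsManifold 𝓘(ℂ, Fin n → ℂ) ω X] in
theorem mem_achart_source (x : X) : x ∈ (achart (Fin n → ℂ) x).1.source :=
  mem_chart_source _ x

theorem chartNormSq_pos {s : Fin N → H0 n X p} {i : atlas (Fin n → ℂ) X} {x : X}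
    (hs : ∃ j, s j x ≠ 0) (hx : x ∈ i.1.source) : 0 < chartNormSq s i x := by
  rw [chartNormSq_eq]
  exact mul_pos (pow_pos (Complex.normSq_pos.2 (jacobian_ne_zero _ _ (mem_achart_source x) hx)) _)
    (valueNormSq_pos hs)

theorem chartNormSq_change (s : Fin N → H0 n X p) {i k : atlas (Fin n → ℂ) X} {x : X}
    (hi : x ∈ i.1.source) (hk : x ∈ k.1.source) :
    chartNormSq s k x = Complex.normSq (jacobian i k x) ^ p * chartNormSq s i x := by
  rw [chartNormSq_eq, chartNormSq_eq, ← mul_assoc, ← mul_pow, ← map_mul,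
    jacobian_mul_jacobian _ _ _ (mem_achart_source x) hi hk]

/-- The chart frame has squared `h_s^p`-norm `1 / chartNormSq` after its `p`-th tensor power; the
`p`-th root gives the exponent. -/
theorem inv_normSqTheta {s : Fin N → H0 n X p} {i : atlas (Fin n → ℂ) X} {x : X}
    (hs : ∃ j, s j x ≠ 0) (hx : x ∈ i.1.source) :
    (normSqTheta s i x)⁻¹ = chartNormSq s i x ^ (-(1 / p) : ℝ) := by
  have hframe : toComplex x (frame i x) = jacobian i (achart (Fin n → ℂ) x) x := by
    have := coordChange_eq_jacobian (p := 1) i (achart (Fin n → ℂ) x) x 1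
    rw [pow_one, mul_one] at this
    exact this
  have hpow : toComplex x (tensorPow p x (frame i x)) =
      jacobian i (achart (Fin n → ℂ) x) x ^ p := by
    rw [← hframe]
    rfl
  have hinv : Complex.normSq (jacobian (achart (Fin n → ℂ) x) i x) *
      Complex.normSq (jacobian i (achart (Fin n → ℂ) x) x) = 1 := by
    rw [← map_mul, jacobian_mul_jacobian _ _ _ hx (mem_achart_source x) hx, jacobian_self _ hx,
      map_one]
  rw [normSqTheta, inv_inv, normSqL, fsInner_eq hs, hpow, Complex.star_def, Complex.mul_conj,
    map_pow, ← Complex.ofReal_div, Complex.ofReal_re, Real.rpow_neg (chartNormSq_pos hs hx).le,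
    ← Real.inv_rpow (chartNormSq_pos hs hx).le, chartNormSq_eq]
  congr 1
  rw [mul_inv, ← inv_pow, ← eq_inv_of_mul_eq_one_right hinv, div_eq_mul_inv]

theorem continuousOn_chartComponent (s : H0 n X p) (i : atlas (Fin n → ℂ) X) :
    ContinuousOn (fun x => chartComponent i x (s x)) i.1.source := by
  have h1 : Continuous fun x => (⟨x, s x⟩ : (anticanonicalCore n X p).TotalSpace) :=
    s.contMDiff.continuous
  have h2 := ((anticanonicalCore n X p).localTriv i).continuousOn.comp h1.continuousOn
    (s := i.1.source) (fun x hx => by rw [Bundle.Trivialization.mem_source]; exact hx)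
  exact continuous_snd.comp_continuousOn h2

theorem continuousOn_chartNormSq (s : Fin N → H0 n X p) (i : atlas (Fin n → ℂ) X) :
    ContinuousOn (chartNormSq s i) i.1.source :=
  continuousOn_finsetSum _ fun j _ =>
    Complex.continuous_normSq.comp_continuousOn (continuousOn_chartComponent (s j) i)

/-- The matrix `(⟨s_j(x), s_k(x)⟩)_{j,k}` for the Fubini-Study metric. -/
def fsMatrix (s : Fin N → H0 n X p) (x : X) : Matrix (Fin N) (Fin N) ℂ :=
  Matrix.of fun j k => fsInner s x (s j x) (s k x)

theorem fsMatrix_apply {s : Fin N → H0 n X p} {x : X} (hs : ∃ j, s j x ≠ 0) (j k : Fin N) :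
    fsMatrix s x j k =
      toComplex x (s j x) * star (toComplex x (s k x)) / (valueNormSq s x : ℂ) :=
  fsInner_eq hs _ _

theorem fsMatrix_apply_chart {s : Fin N → H0 n X p} {i : atlas (Fin n → ℂ) X} {x : X}
    (hs : ∃ j, s j x ≠ 0) (hx : x ∈ i.1.source) (j k : Fin N) :
    fsMatrix s x j k = chartComponent i x (s j x) * star (chartComponent i x (s k x)) /
      (chartNormSq s i x : ℂ) := by
  have h := jacobian_ne_zero _ _ (mem_achart_source x) hx
  have h2 : (starRingEnd ℂ) (jacobian (achart (Fin n → ℂ) x) i x) ≠ 0 := by simpa using h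
  rw [fsMatrix_apply hs, chartComponent_eq, chartComponent_eq, chartNormSq_eq, Complex.ofReal_mul,
    Complex.ofReal_pow, ← Complex.mul_conj]
  have hσ : (valueNormSq s x : ℂ) ≠ 0 := by exact_mod_cast (valueNormSq_pos hs).ne'
  simp only [Complex.star_def, map_mul, map_pow]
  field_simp
  rw [mul_pow]
  ring

theorem continuous_fsMatrix {s : Fin N → H0 n X p} (hs : ∀ x, ∃ j, s j x ≠ 0) :
    Continuous (fsMatrix s) := by
  refine continuous_matrix fun j k => continuous_iff_continuousAt.2 fun x => ?_
  set i := achart (Fin n → ℂ) x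
  have hnhds : i.1.source ∈ nhds x := i.1.open_source.mem_nhds (mem_achart_source x)
  have hc : ContinuousOn (fun y => chartComponent i y (s j y) *
      star (chartComponent i y (s k y)) / (chartNormSq s i y : ℂ)) i.1.source := by
    refine ((continuousOn_chartComponent _ _).mul
      (continuous_star.comp_continuousOn (continuousOn_chartComponent _ _))).div
      (Complex.continuous_ofReal.comp_continuousOn (continuousOn_chartNormSq s i)) fun y hy => ?_
    exact Complex.ofReal_ne_zero.2 (chartNormSq_pos (hs y) hy).ne'
  refine (hc.continuousAt hnhds).congr ?_
  filter_upwards [hnhds] with y hy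
  exact (fsMatrix_apply_chart (hs y) hy j k).symm

theorem fsMatrix_isHermitian {s : Fin N → H0 n X p} {x : X} (hs : ∃ j, s j x ≠ 0) :
    (fsMatrix s x).IsHermitian := by
  ext j k
  rw [Matrix.conjTranspose_apply, fsMatrix_apply hs, fsMatrix_apply hs]
  simp only [Complex.star_def, map_div₀, map_mul, Complex.conj_conj, Complex.conj_ofReal]
  ring

theorem sum_smul_apply (c : Fin N → ℂ) (s : Fin N → H0 n X p) (x : X) :
    (∑ k, c k • s k : H0 n X p) x = ∑ k, c k • s k x := by
  have h : ∀ t : Finset (Fin N), (∑ k ∈ t, c k • s k : H0 n X p) x = ∑ k ∈ t, c k • s k x := by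
    intro t
    induction t using Finset.cons_induction with
    | empty => rfl
    | cons a t ha ih => rw [Finset.sum_cons, Finset.sum_cons, ← ih]; rfl
  exact h _

theorem act_apply (G : Matrix (Fin N) (Fin N) ℂ) (s : Fin N → H0 n X p) (j : Fin N) (x : X) :
    act G s j x = ∑ k, G j k • s k x :=
  sum_smul_apply _ s x

theorem toComplex_act (G : Matrix (Fin N) (Fin N) ℂ) (s : Fin N → H0 n X p) (j : Fin N) (x : X) :
    toComplex x (act G s j x) = ∑ k, G j k * toComplex x (s k x) := by
  rw [act_apply, map_sum]
  rfl

theorem act_mul (G H : Matrix (Fin N) (Fin N) ℂ) (s : Fin N → H0 n X p) :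
    act (G * H) s = act G (act H s) := by
  funext j
  simp only [act, Matrix.mul_apply, Finset.sum_smul, Finset.smul_sum, smul_smul]
  exact Finset.sum_comm

theorem act_one (s : Fin N → H0 n X p) : act 1 s = s := by
  funext j
  simp [act, Matrix.one_apply]

theorem exists_act_ne_zero {G : Matrix (Fin N) (Fin N) ℂ} (hG : IsUnit G)
    {s : Fin N → H0 n X p} {x : X} (hs : ∃ j, s j x ≠ 0) : ∃ j, act G s j x ≠ 0 := by
  by_contra! h
  obtain ⟨j, hj⟩ := hs
  obtain ⟨H, hH⟩ := hG.exists_left_inv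
  apply hj
  have : s j x = act (H * G) s j x := by rw [hH, act_one]
  rw [this, act_mul, act_apply]
  exact Finset.sum_eq_zero fun k _ => by rw [h k, smul_zero]

/-- The trace of `G P(x) G^*`, where `P(x)` is the matrix of the Fubini-Study products of `s`. -/
def traceRatio (G : Matrix (Fin N) (Fin N) ℂ) (s : Fin N → H0 n X p) (x : X) : ℝ :=
  (G * fsMatrix s x * Gᴴ).trace.re

/-- The vector `σ` of values of `s` satisfies `σ σ^* = valueNormSq • P`, and `G` acts by `σ ↦ G σ`.
The changes of the norm, the metric and the volume form all follow from this. -/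
theorem act_products {s : Fin N → H0 n X p} {x : X} (hs : ∃ j, s j x ≠ 0)
    (G : Matrix (Fin N) (Fin N) ℂ) (j k : Fin N) :
    toComplex x (act G s j x) * star (toComplex x (act G s k x)) =
      (G * fsMatrix s x * Gᴴ) j k * (valueNormSq s x : ℂ) := by
  have hσ : (valueNormSq s x : ℂ) ≠ 0 := by exact_mod_cast (valueNormSq_pos hs).ne'
  rw [toComplex_act, toComplex_act, star_sum, Finset.sum_mul_sum, Matrix.mul_apply, Finset.sum_mul,
    Finset.sum_comm]
  refine Finset.sum_congr rfl fun l _ => ?_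
  rw [Matrix.mul_apply, Finset.sum_mul, Finset.sum_mul]
  refine Finset.sum_congr rfl fun q _ => ?_
  rw [fsMatrix_apply hs, Matrix.conjTranspose_apply, star_mul']
  field_simp

theorem valueNormSq_act {s : Fin N → H0 n X p} {x : X} (hs : ∃ j, s j x ≠ 0)
    (G : Matrix (Fin N) (Fin N) ℂ) :
    valueNormSq (act G s) x = traceRatio G s x * valueNormSq s x := by
  have h : ((valueNormSq (act G s) x : ℝ) : ℂ) =
      (G * fsMatrix s x * Gᴴ).trace * (valueNormSq s x : ℂ) := by
    rw [Matrix.trace, Finset.sum_mul, valueNormSq, Complex.ofReal_sum]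
    refine Finset.sum_congr rfl fun j _ => ?_
    rw [Matrix.diag_apply, ← act_products hs, Complex.star_def, Complex.mul_conj]
  have h2 := congrArg Complex.re h
  rwa [Complex.re_mul_ofReal, Complex.ofReal_re] at h2

/-- It is the ratio of the squared norms of the values of `G s` and `s`, and an invertible `G`
creates no base point. -/
theorem traceRatio_pos {s : Fin N → H0 n X p} {x : X} (hs : ∃ j, s j x ≠ 0)
    {G : Matrix (Fin N) (Fin N) ℂ} (hG : IsUnit G) : 0 < traceRatio G s x := by
  have h := valueNormSq_pos (exists_act_ne_zero hG hs)
  rw [valueNormSq_act hs] at h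
  exact pos_of_mul_pos_left h (valueNormSq_pos hs).le

theorem chartNormSq_act {s : Fin N → H0 n X p} {x : X} (hs : ∃ j, s j x ≠ 0)
    (G : Matrix (Fin N) (Fin N) ℂ) (i : atlas (Fin n → ℂ) X) :
    chartNormSq (act G s) i x = traceRatio G s x * chartNormSq s i x := by
  rw [chartNormSq_eq, chartNormSq_eq, valueNormSq_act hs]
  ring

theorem fsMatrix_act {s : Fin N → H0 n X p} {x : X} (hs : ∃ j, s j x ≠ 0)
    {G : Matrix (Fin N) (Fin N) ℂ} (hG : IsUnit G) (j k : Fin N) :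
    fsMatrix (act G s) x j k = (G * fsMatrix s x * Gᴴ) j k / (traceRatio G s x : ℂ) := by
  have hσ : (valueNormSq s x : ℂ) ≠ 0 := by exact_mod_cast (valueNormSq_pos hs).ne'
  rw [fsMatrix_apply (exists_act_ne_zero hG hs), act_products hs, valueNormSq_act hs,
    Complex.ofReal_mul, mul_div_mul_right _ _ hσ]

theorem continuous_traceRatio {s : Fin N → H0 n X p} (hs : ∀ x, ∃ j, s j x ≠ 0)
    (G : Matrix (Fin N) (Fin N) ℂ) : Continuous (traceRatio G s) :=
  Complex.continuous_re.comp
    ((continuous_const.matrix_mul (continuous_fsMatrix hs)).matrix_mul continuous_const).matrix_trace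

end PointwiseMetric

end

/-! ### The anticanonical volume form as a measure. -/

noncomputable section

/-- A positive finite density has an inverse density, so `withDensity f` is an order automorphism of
the lattice of measures and preserves suprema. -/
theorem withDensity_iSup_measure {α ι : Type*} [MeasurableSpace α] (μ : ι → Measure α)
    {f : α → ENNReal} (hf : Measurable f) (h0 : ∀ x, f x ≠ 0) (htop : ∀ x, f x ≠ ⊤) :
    (⨆ i, μ i).withDensity f = ⨆ i, (μ i).withDensity f := by
  have mono (g : α → ENNReal) {ν ν' : Measure α} (h : ν ≤ ν') :
      ν.withDensity g ≤ ν'.withDensity g := by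
    refine Measure.le_iff.2 fun s hs => ?_
    rw [withDensity_apply _ hs, withDensity_apply _ hs]
    exact lintegral_mono' (Measure.restrict_mono le_rfl h) le_rfl
  have hinv (ν : Measure α) : (ν.withDensity f).withDensity (fun x => (f x)⁻¹) = ν :=
    withDensity_inv_same hf (Filter.Eventually.of_forall h0) (Filter.Eventually.of_forall htop)
  have hinv' (ν : Measure α) : (ν.withDensity fun x => (f x)⁻¹).withDensity f = ν := by
    have := withDensity_inv_same (μ := ν) (f := fun x => (f x)⁻¹) hf.inv
      (Filter.Eventually.of_forall fun x => ENNReal.inv_ne_zero.2 (htop x))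
      (Filter.Eventually.of_forall fun x => ENNReal.inv_ne_top.2 (h0 x))
    simp only [inv_inv] at this
    exact this
  refine le_antisymm ?_ (iSup_le fun i => mono f (le_iSup μ i))
  rw [← hinv' (⨆ i, (μ i).withDensity f)]
  refine mono f (iSup_le fun i => ?_)
  rw [← hinv (μ i)]
  exact mono _ (le_iSup (fun i => (μ i).withDensity f) i)

section VolumeForm

variable {n : ℕ} {X : Type*} [TopologicalSpace X] [ChartedSpace (Fin n → ℂ) X]
  [IsManifold 𝓘(ℂ, Fin n → ℂ) ω X] {p N : ℕ}

/-- Links the transition functions defining the bundle with the derivative needed in the change of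
variables formula. -/
theorem hasFDerivAt_chart_change (i k : atlas (Fin n → ℂ) X) {x : X} (hi : x ∈ i.1.source)
    (hk : x ∈ k.1.source) :
    HasFDerivAt (k.1 ∘ i.1.symm)
      ((tangentBundleCore 𝓘(ℂ, Fin n → ℂ) X).coordChange i k x) (i.1 x) := by
  have h := ModelWithCorners.contDiffWithinAt_extendCoordChange' (I := 𝓘(ℂ, Fin n → ℂ)) (n := ω)
    (IsManifold.subset_maximalAtlas i.2) (IsManifold.subset_maximalAtlas k.2) hi hk
  rw [tangentBundleCore_coordChange]
  have h2 := (h.differentiableWithinAt (by simp)).hasFDerivWithinAt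
  simp only [modelWithCornersSelf_coe, Set.range_id, hasFDerivWithinAt_univ] at h2
  simpa using h2

/-- The density of the volume form with respect to the Lebesgue measure in a chart. -/
def chartDensity (s : Fin N → H0 n X p) (i : atlas (Fin n → ℂ) X) (x : X) : ENNReal :=
  ENNReal.ofReal (2 ^ n * chartNormSq s i x ^ (-(1 / p) : ℝ))

theorem continuousOn_chartDensity {s : Fin N → H0 n X p} (hs : ∀ x, ∃ j, s j x ≠ 0)
    (i : atlas (Fin n → ℂ) X) : ContinuousOn (chartDensity s i) i.1.source := by
  refine ENNReal.continuous_ofReal.comp_continuousOn (continuousOn_const.mul ?_)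
  exact (continuousOn_chartNormSq s i).rpow_const fun x hx => Or.inl (chartNormSq_pos (hs x) hx).ne'

/-- `chartNormSq` scales by `|J| ^ (2p)`, so its power `-1/p` scales by `|J| ^ (-2)`, which cancels
the real Jacobian `|J| ^ 2`. This is where `L` being anticanonical matters. -/
theorem chartDensity_change (hp : 0 < p) {s : Fin N → H0 n X p} (hs : ∀ x, ∃ j, s j x ≠ 0)
    {i k : atlas (Fin n → ℂ) X} {x : X} (hi : x ∈ i.1.source) (hk : x ∈ k.1.source) :
    ENNReal.ofReal (Complex.normSq (jacobian i k x)) * chartDensity s k x = chartDensity s i x := by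
  have hJ := Complex.normSq_pos.2 (jacobian_ne_zero _ _ hi hk)
  rw [chartDensity, chartDensity, ← ENNReal.ofReal_mul hJ.le, chartNormSq_change s hi hk,
    Real.mul_rpow (by positivity) (chartNormSq_pos (hs x) hi).le,
    ← Real.rpow_natCast (Complex.normSq (jacobian i k x)),
    ← Real.rpow_mul hJ.le]
  have : (p : ℝ) * (-(1 / p)) = -1 := by
    have : (p : ℝ) ≠ 0 := by exact_mod_cast hp.ne'
    field_simp
  rw [this, Real.rpow_neg_one]
  congr 1
  field_simp

variable [MeasurableSpace X] [BorelSpace X]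

omit [IsManifold 𝓘(ℂ, Fin n → ℂ) ω X] in
theorem aemeasurable_chart_symm (i : atlas (Fin n → ℂ) X) :
    AEMeasurable i.1.symm ((volume : Measure (Fin n → ℂ)).restrict i.1.target) :=
  i.1.continuousOn_symm.aemeasurable i.1.open_target.measurableSet

omit [BorelSpace X] in
theorem chartVolume_eq {s : Fin N → H0 n X p} (hs : ∀ x, ∃ j, s j x ≠ 0)
    (i : atlas (Fin n → ℂ) X) :
    chartVolume s i = (((volume : Measure (Fin n → ℂ)).restrict i.1.target).withDensity
      fun z => chartDensity s i (i.1.symm z)).map i.1.symm := by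
  rw [chartVolume]
  congr 1
  refine withDensity_congr_ae ?_
  filter_upwards [ae_restrict_mem i.1.open_target.measurableSet] with z hz
  rw [div_eq_mul_inv, inv_normSqTheta (hs _) (i.1.map_target hz), chartDensity]

theorem chartVolume_apply {s : Fin N → H0 n X p} (hs : ∀ x, ∃ j, s j x ≠ 0)
    (i : atlas (Fin n → ℂ) X) {E : Set X} (hE : MeasurableSet E) :
    chartVolume s i E = ∫⁻ z in i.1.symm ⁻¹' E ∩ i.1.target, chartDensity s i (i.1.symm z) := by
  rw [chartVolume_eq hs, Measure.map_apply_of_aemeasurable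
    ((aemeasurable_chart_symm i).mono_ac (withDensity_absolutelyContinuous _ _)) hE,
    withDensity_apply', Measure.restrict_restrict' i.1.open_target.measurableSet]

omit [IsManifold 𝓘(ℂ, Fin n → ℂ) ω X] in
theorem measurableSet_chart_preimage (i : atlas (Fin n → ℂ) X) {E : Set X}
    (hE : MeasurableSet E) : MeasurableSet (i.1.symm ⁻¹' E ∩ i.1.target) := by
  rw [Set.inter_comm, ← Subtype.image_preimage_coe]
  refine (MeasurableEmbedding.subtype_coe i.1.open_target.measurableSet).measurableSet_image.2 ?_
  exact (continuousOn_iff_continuous_domRestrict.1 i.1.continuousOn_symm).measurable hE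

theorem chartVolume_apply_source {s : Fin N → H0 n X p} (hs : ∀ x, ∃ j, s j x ≠ 0)
    (i : atlas (Fin n → ℂ) X) {E : Set X} (hE : MeasurableSet E) :
    chartVolume s i (E ∩ i.1.source) = chartVolume s i E := by
  rw [chartVolume_apply hs i hE, chartVolume_apply hs i (hE.inter i.1.open_source.measurableSet)]
  congr 2
  ext z
  simp only [Set.mem_inter_iff, Set.mem_preimage]
  exact ⟨fun h => ⟨h.1.1, h.2⟩, fun h => ⟨⟨h.1, i.1.map_target h.2⟩, h.2⟩⟩

theorem det_restrictScalars_real (A : (Fin n → ℂ) →L[ℂ] (Fin n → ℂ)) :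
    (A.restrictScalars ℝ).det = Complex.normSq A.det := by
  rw [← Algebra.norm_complex_apply]
  exact LinearMap.det_restrictScalars

/-- The local volume forms agree on overlaps. -/
theorem chartVolume_overlap (hp : 0 < p) {s : Fin N → H0 n X p} (hs : ∀ x, ∃ j, s j x ≠ 0)
    (i k : atlas (Fin n → ℂ) X) {E : Set X} (hE : MeasurableSet E) (hi : E ⊆ i.1.source)
    (hk : E ⊆ k.1.source) : chartVolume s i E = chartVolume s k E := by
  rw [chartVolume_apply hs i hE, chartVolume_apply hs k hE]
  set S := i.1.symm ⁻¹' E ∩ i.1.target with hS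
  have himage : k.1.symm ⁻¹' E ∩ k.1.target = (k.1 ∘ i.1.symm) '' S := by
    ext w
    constructor
    · rintro ⟨hw, hwt⟩
      refine ⟨i.1 (k.1.symm w), ⟨?_, i.1.map_source (hi hw)⟩, ?_⟩
      · rw [Set.mem_preimage, i.1.left_inv (hi hw)]
        exact hw
      · rw [Function.comp_apply, i.1.left_inv (hi hw), k.1.right_inv hwt]
    · rintro ⟨z, ⟨hz, hzt⟩, rfl⟩
      refine ⟨?_, k.1.map_source (hk hz)⟩
      rw [Set.mem_preimage, Function.comp_apply, k.1.left_inv (hk hz)]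
      exact hz
  have hinj : Set.InjOn (k.1 ∘ i.1.symm) S := by
    intro z hz z' hz' h
    exact i.1.symm.injOn hz.2 hz'.2 (k.1.injOn (hk hz.1) (hk hz'.1) h)
  have hderiv : ∀ z ∈ S, HasFDerivWithinAt (k.1 ∘ i.1.symm)
      (((tangentBundleCore 𝓘(ℂ, Fin n → ℂ) X).coordChange i k (i.1.symm z)).restrictScalars ℝ)
      S z := by
    intro z hz
    have := hasFDerivAt_chart_change i k (hi hz.1) (hk hz.1)
    rw [i.1.right_inv hz.2] at this
    exact (this.restrictScalars ℝ).hasFDerivWithinAt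
  rw [himage, lintegral_image_eq_lintegral_abs_det_fderiv_mul volume
    (measurableSet_chart_preimage i hE) hderiv hinj]
  refine setLIntegral_congr_fun (measurableSet_chart_preimage i hE) fun z hz => ?_
  simp only [Function.comp_apply]
  rw [det_restrictScalars_real, abs_of_nonneg (Complex.normSq_nonneg _), k.1.left_inv (hk hz.1)]
  exact (chartDensity_change hp hs (hi hz.1) (hk hz.1)).symm

theorem chartVolume_compact_lt_top {s : Fin N → H0 n X p} (hs : ∀ x, ∃ j, s j x ≠ 0)
    (i : atlas (Fin n → ℂ) X) {K : Set X} (hK : IsCompact K) (hKm : MeasurableSet K)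
    (hKi : K ⊆ i.1.source) : chartVolume s i K < ⊤ := by
  rw [chartVolume_apply hs i hKm]
  have himage : i.1.symm ⁻¹' K ∩ i.1.target = i.1 '' K := by
    rw [Set.inter_comm, i.1.image_eq_target_inter_inv_preimage hKi]
  have hcpt : IsCompact (i.1.symm ⁻¹' K ∩ i.1.target) := by
    rw [himage]
    exact hK.image_of_continuousOn (i.1.continuousOn.mono hKi)
  obtain ⟨C, hC⟩ : ∃ C : ℝ, ∀ x ∈ K, 2 ^ n * chartNormSq s i x ^ (-(1 / p) : ℝ) ≤ C := by
    have hc : ContinuousOn (fun x => 2 ^ n * chartNormSq s i x ^ (-(1 / p) : ℝ)) K :=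
      continuousOn_const.mul (((continuousOn_chartNormSq s i).mono hKi).rpow_const
        fun x hx => Or.inl (chartNormSq_pos (hs x) (hKi hx)).ne')
    obtain ⟨C, hC⟩ := hK.bddAbove_image hc
    exact ⟨C, fun x hx => hC ⟨x, hx, rfl⟩⟩
  refine setLIntegral_lt_top_of_le_nnreal hcpt.measure_lt_top.ne ⟨C.toNNReal, fun z hz => ?_⟩
  exact ENNReal.ofReal_le_ofReal (hC _ hz.1)

/-- Finitely many compact sets, each inside a chart, cover `X`, and the density is bounded on each.
-/
theorem isFiniteMeasure_volumeForm [T2Space X] [CompactSpace X] (hp : 0 < p)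
    {s : Fin N → H0 n X p} (hs : ∀ x, ∃ j, s j x ≠ 0) : IsFiniteMeasure (volumeForm s) := by
  have : LocallyCompactSpace X := inferInstance
  have hnhds (x : X) : ∃ K, K ∈ nhds x ∧ K ⊆ (achart (Fin n → ℂ) x).1.source ∧ IsCompact K := by
    obtain ⟨K, hK, hKs, hKc⟩ := local_compact_nhds
      ((achart (Fin n → ℂ) x).1.open_source.mem_nhds (mem_achart_source x))
    exact ⟨K, hK, hKs, hKc⟩
  choose K hK hKs hKc using hnhds
  obtain ⟨T, hT⟩ := CompactSpace.elim_nhds_subcover K hK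
  have hKm (x : X) : MeasurableSet (K x) := (hKc x).isClosed.measurableSet
  -- A bound on the supremum may be checked on one chart at a time; agreement on overlaps lets each
  -- piece in `K x` be measured in the fixed chart at `x`.
  have hle : volumeForm s ≤ ∑ x ∈ T, (chartVolume s (achart (Fin n → ℂ) x)).restrict (K x) := by
    refine iSup_le fun i => Measure.le_iff.2 fun E hE => ?_
    rw [Measure.finsetSum_apply, ← chartVolume_apply_source hs i hE]
    have hsub : E ∩ i.1.source ⊆ ⋃ x ∈ T, (E ∩ i.1.source) ∩ K x := by
      rw [← Set.inter_iUnion₂, hT, Set.top_eq_univ, Set.inter_univ]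
    refine (measure_mono hsub).trans ((measure_biUnion_finset_le _ _).trans
      (Finset.sum_le_sum fun x _ => ?_))
    rw [chartVolume_overlap hp hs i (achart (Fin n → ℂ) x)
      ((hE.inter i.1.open_source.measurableSet).inter (hKm x))
      (fun y hy => hy.1.2) (fun y hy => hKs x hy.2), Measure.restrict_apply hE]
    exact measure_mono fun y hy => ⟨hy.1.1, hy.2⟩
  refine ⟨(hle Set.univ).trans_lt ?_⟩
  rw [Measure.finsetSum_apply]
  refine ENNReal.sum_lt_top.2 fun x _ => ?_
  rw [Measure.restrict_apply MeasurableSet.univ, Set.univ_inter]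
  exact chartVolume_compact_lt_top hs _ (hKc x) (hKm x) (hKs x)

/-- The density of the volume form of `G s` with respect to that of `s`. -/
def volumeRatio (G : Matrix (Fin N) (Fin N) ℂ) (s : Fin N → H0 n X p) (x : X) : ℝ :=
  traceRatio G s x ^ (-(1 / p) : ℝ)

omit [MeasurableSpace X] [BorelSpace X] in
theorem volumeRatio_pos {s : Fin N → H0 n X p} {x : X} (hs : ∃ j, s j x ≠ 0)
    {G : Matrix (Fin N) (Fin N) ℂ} (hG : IsUnit G) : 0 < volumeRatio G s x :=
  Real.rpow_pos_of_pos (traceRatio_pos hs hG) _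

omit [MeasurableSpace X] [BorelSpace X] in
theorem continuous_volumeRatio {s : Fin N → H0 n X p} (hs : ∀ x, ∃ j, s j x ≠ 0)
    {G : Matrix (Fin N) (Fin N) ℂ} (hG : IsUnit G) : Continuous (volumeRatio G s) :=
  (continuous_traceRatio hs G).rpow_const fun x => Or.inl (traceRatio_pos (hs x) hG).ne'

omit [MeasurableSpace X] [BorelSpace X] in
theorem chartDensity_act {s : Fin N → H0 n X p} (hs : ∀ x, ∃ j, s j x ≠ 0)
    {G : Matrix (Fin N) (Fin N) ℂ} (hG : IsUnit G) {i : atlas (Fin n → ℂ) X} {x : X}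
    (hx : x ∈ i.1.source) :
    chartDensity (act G s) i x = chartDensity s i x * ENNReal.ofReal (volumeRatio G s x) := by
  have hpos := chartNormSq_pos (hs x) hx
  rw [chartDensity, chartDensity, volumeRatio, chartNormSq_act (hs x),
    Real.mul_rpow (traceRatio_pos (hs x) hG).le hpos.le, ← ENNReal.ofReal_mul (by positivity)]
  congr 1
  ring

theorem chartVolume_act {s : Fin N → H0 n X p} (hs : ∀ x, ∃ j, s j x ≠ 0)
    {G : Matrix (Fin N) (Fin N) ℂ} (hG : IsUnit G) (i : atlas (Fin n → ℂ) X) :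
    chartVolume (act G s) i =
      (chartVolume s i).withDensity fun x => ENNReal.ofReal (volumeRatio G s x) := by
  have hρ : Measurable fun x => ENNReal.ofReal (volumeRatio G s x) :=
    (continuous_volumeRatio hs hG).measurable.ennreal_ofReal
  have hsymm := aemeasurable_chart_symm i
  have hdens : AEMeasurable (fun z => chartDensity s i (i.1.symm z))
      ((volume : Measure (Fin n → ℂ)).restrict i.1.target) :=
    ((continuousOn_chartDensity hs i).comp i.1.continuousOn_symm
      fun z hz => i.1.map_target hz).aemeasurable i.1.open_target.measurableSet
  ext E hE
  rw [chartVolume_apply (fun x => exists_act_ne_zero hG (hs x)) i hE, withDensity_apply _ hE,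
    chartVolume_eq hs]
  have hsymm' := hsymm.mono_ac (withDensity_absolutelyContinuous
    ((volume : Measure (Fin n → ℂ)).restrict i.1.target) fun z => chartDensity s i (i.1.symm z))
  have hS := measurableSet_chart_preimage i hE
  have hcomp : AEMeasurable (fun z => ENNReal.ofReal (volumeRatio G s (i.1.symm z)))
      ((volume : Measure (Fin n → ℂ)).restrict (i.1.symm ⁻¹' E ∩ i.1.target)) :=
    hρ.comp_aemeasurable
      (hsymm.mono_measure (Measure.restrict_mono Set.inter_subset_right le_rfl))
  rw [Measure.restrict_map_of_aemeasurable hsymm' hE, lintegral_map' hρ.aemeasurable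
    (hsymm'.mono_measure Measure.restrict_le_self), restrict_withDensity',
    Measure.restrict_restrict' i.1.open_target.measurableSet,
    lintegral_withDensity_eq_lintegral_mul₀ (hdens.mono_measure
      (Measure.restrict_mono Set.inter_subset_right le_rfl))
      hcomp]
  exact setLIntegral_congr_fun hS fun z hz => chartDensity_act hs hG (i.1.map_target hz.2)

theorem volumeForm_act {s : Fin N → H0 n X p} (hs : ∀ x, ∃ j, s j x ≠ 0)
    {G : Matrix (Fin N) (Fin N) ℂ} (hG : IsUnit G) :
    volumeForm (act G s) =
      (volumeForm s).withDensity fun x => ENNReal.ofReal (volumeRatio G s x) := by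
  rw [volumeForm, volumeForm, withDensity_iSup_measure]
  · exact iSup_congr fun i => chartVolume_act hs hG i
  · exact (continuous_volumeRatio hs hG).measurable.ennreal_ofReal
  · exact fun x => (ENNReal.ofReal_pos.2 (volumeRatio_pos (hs x) hG)).ne'
  · exact fun x => ENNReal.ofReal_ne_top

theorem integral_volumeForm_act {s : Fin N → H0 n X p} (hs : ∀ x, ∃ j, s j x ≠ 0)
    {G : Matrix (Fin N) (Fin N) ℂ} (hG : IsUnit G) (f : X → ℂ) :
    ∫ x, f x ∂(volumeForm (act G s)) = ∫ x, (volumeRatio G s x : ℂ) * f x ∂(volumeForm s) := by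
  rw [volumeForm_act hs hG, integral_withDensity_eq_integral_toReal_smul
    (continuous_volumeRatio hs hG).measurable.ennreal_ofReal
    (Filter.Eventually.of_forall fun x => ENNReal.ofReal_lt_top)]
  refine integral_congr_ae (Filter.Eventually.of_forall fun x => ?_)
  simp only [ENNReal.toReal_ofReal (volumeRatio_pos (hs x) hG).le, Complex.real_smul]

end VolumeForm

end

/-! ### Differentiating congruences by exponentials. -/

noncomputable section

section ExpCalculus

variable {N : ℕ}

section
open scoped Matrix.Norms.Frobenius

theorem continuous_matrix_exp :
    Continuous fun A : Matrix (Fin N) (Fin N) ℂ => NormedSpace.exp A :=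
  NormedSpace.exp_continuous

theorem hasDerivAt_matrix_exp_entry (A : Matrix (Fin N) (Fin N) ℂ) (t : ℝ) (j k : Fin N) :
    HasDerivAt (fun t : ℝ => NormedSpace.exp ((t : ℂ) • A) j k)
      ((NormedSpace.exp ((t : ℂ) • A) * A) j k) t := by
  have h := hasDerivAt_exp_smul_const (𝕂 := ℝ) A t
  simp only [← Complex.coe_smul] at h
  let L : Matrix (Fin N) (Fin N) ℂ →L[ℝ] ℂ :=
    LinearMap.toContinuousLinearMap (Matrix.entryLinearMap ℝ ℂ j k)
  exact L.hasFDerivAt.comp_hasDerivAt t h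

end

/-- The congruence of `R` by `e^{tA}`. -/
def expCongr (A R : Matrix (Fin N) (Fin N) ℂ) (t : ℝ) : Matrix (Fin N) (Fin N) ℂ :=
  NormedSpace.exp ((t : ℂ) • A) * R * (NormedSpace.exp ((t : ℂ) • A))ᴴ

/-- The derivative is again an `expCongr`, with another middle matrix, so `continuous_expCongr`
serves for it too. -/
theorem hasDerivAt_expCongr_entry (A R : Matrix (Fin N) (Fin N) ℂ) (t : ℝ) (j k : Fin N) :
    HasDerivAt (fun t => expCongr A R t j k) (expCongr A (A * R + R * Aᴴ) t j k) t := by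
  have h : expCongr A (A * R + R * Aᴴ) t j k = ∑ q, ∑ l,
      ((NormedSpace.exp ((t : ℂ) • A) * A) j l * R l q *
          star (NormedSpace.exp ((t : ℂ) • A) k q) +
        NormedSpace.exp ((t : ℂ) • A) j l * R l q *
          star ((NormedSpace.exp ((t : ℂ) • A) * A) k q)) := by
    set E := NormedSpace.exp ((t : ℂ) • A) with hE
    have h1 : expCongr A (A * R + R * Aᴴ) t = E * A * R * Eᴴ + E * R * (E * A)ᴴ := by
      rw [expCongr, ← hE, Matrix.conjTranspose_mul, Matrix.mul_add, Matrix.add_mul]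
      simp only [Matrix.mul_assoc]
    rw [h1, Matrix.add_apply, Matrix.mul_apply, Matrix.mul_apply, ← Finset.sum_add_distrib]
    refine Finset.sum_congr rfl fun q _ => ?_
    rw [Matrix.mul_apply, Matrix.mul_apply (M := E), Finset.sum_mul, Finset.sum_mul,
      ← Finset.sum_add_distrib]
    rfl
  have hfun : (fun t => expCongr A R t j k) = fun t : ℝ => ∑ q, ∑ l,
      NormedSpace.exp ((t : ℂ) • A) j l * R l q * star (NormedSpace.exp ((t : ℂ) • A) k q) := by
    funext t
    rw [expCongr, Matrix.mul_apply]
    refine Finset.sum_congr rfl fun q _ => ?_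
    rw [Matrix.mul_apply, Finset.sum_mul]
    rfl
  rw [h, hfun]
  refine HasDerivAt.fun_sum fun q _ => HasDerivAt.fun_sum fun l _ => ?_
  exact ((hasDerivAt_matrix_exp_entry A t j l).mul_const _).fun_mul
    (hasDerivAt_matrix_exp_entry A t k q).star

theorem hasDerivAt_expCongr_trace (A R : Matrix (Fin N) (Fin N) ℂ) (t : ℝ) :
    HasDerivAt (fun t => (expCongr A R t).trace.re) (expCongr A (A * R + R * Aᴴ) t).trace.re t :=
  Complex.reCLM.hasFDerivAt.comp_hasDerivAt t
    (HasDerivAt.fun_sum fun j _ => hasDerivAt_expCongr_entry A R t j j)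

theorem continuous_expCongr {Y : Type*} [TopologicalSpace Y] (A : Matrix (Fin N) (Fin N) ℂ)
    {R : Y → Matrix (Fin N) (Fin N) ℂ} {t : Y → ℝ} (hR : Continuous R) (ht : Continuous t) :
    Continuous fun y => expCongr A (R y) (t y) := by
  have h : Continuous fun y => NormedSpace.exp (((t y : ℝ) : ℂ) • A) :=
    continuous_matrix_exp.comp ((Complex.continuous_ofReal.comp ht).smul continuous_const)
  exact (h.matrix_mul hR).matrix_mul h.matrix_conjTranspose

end ExpCalculus

/-! ### Equivariance and regularity of the moment integral. -/

section MomentIntegral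

variable {N : ℕ} {X : Type*} [MeasurableSpace X]

/-- The integral of `Tr(Q)^a Q`, where `Q = G P(x) G^*`. -/
def momentIntegral (ν : Measure X) (P : X → Matrix (Fin N) (Fin N) ℂ) (a : ℝ)
    (G : Matrix (Fin N) (Fin N) ℂ) : Matrix (Fin N) (Fin N) ℂ :=
  Matrix.of fun j k =>
    ∫ x, (((G * P x * Gᴴ).trace.re ^ a : ℝ) : ℂ) * (G * P x * Gᴴ) j k ∂ν

/-- The projection of matrices onto those of zero trace. -/
def traceless (M : Matrix (Fin N) (Fin N) ℂ) : Matrix (Fin N) (Fin N) ℂ :=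
  M - (M.trace / N) • (1 : Matrix (Fin N) (Fin N) ℂ)

theorem trace_traceless (M : Matrix (Fin N) (Fin N) ℂ) : (traceless M).trace = 0 := by
  -- For `N = 0` the quotient by `N` is a default value, but the trace is an empty sum.
  rcases Nat.eq_zero_or_pos N with rfl | hN
  · simp [Matrix.trace]
  · have : (N : ℂ) ≠ 0 := by exact_mod_cast hN.ne'
    rw [traceless, Matrix.trace_sub, Matrix.trace_smul, Matrix.trace_one, Fintype.card_fin,
      smul_eq_mul, div_mul_cancel₀ _ this, sub_self]

theorem traceless_isHermitian {M : Matrix (Fin N) (Fin N) ℂ} (hM : M.IsHermitian) :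
    (traceless M).IsHermitian := by
  have h : star M.trace = M.trace := by
    rw [← Matrix.trace_conjTranspose, hM.eq]
  refine hM.sub ?_
  rw [Matrix.IsHermitian, Matrix.conjTranspose_smul, Matrix.conjTranspose_one, star_div₀, h,
    star_natCast]

theorem traceless_unitary_conj {U : Matrix (Fin N) (Fin N) ℂ}
    (hU : U ∈ Matrix.unitaryGroup (Fin N) ℂ) (M : Matrix (Fin N) (Fin N) ℂ) :
    traceless (U * M * Uᴴ) = U * traceless M * Uᴴ := by
  rw [traceless, traceless, Matrix.mul_sub, Matrix.sub_mul, Matrix.trace_mul_cycle,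
    conjTranspose_mul_self_of_unitary hU, Matrix.one_mul, Matrix.mul_smul, Matrix.smul_mul,
    Matrix.mul_one, self_mul_conjTranspose_of_unitary hU]

theorem momentIntegral_isHermitian (ν : Measure X) {P : X → Matrix (Fin N) (Fin N) ℂ}
    (hP : ∀ x, (P x).IsHermitian) (a : ℝ) (G : Matrix (Fin N) (Fin N) ℂ) :
    (momentIntegral ν P a G).IsHermitian := by
  ext j k
  rw [Matrix.conjTranspose_apply, momentIntegral, Matrix.of_apply, Matrix.of_apply,
    Complex.star_def, ← integral_conj]
  refine integral_congr_ae (Filter.Eventually.of_forall fun x => ?_)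
  simp only [map_mul, Complex.conj_ofReal]
  rw [← (Matrix.isHermitian_mul_mul_conjTranspose G (hP x)).apply j k, Complex.star_def]

variable [TopologicalSpace X] [CompactSpace X] [BorelSpace X]

theorem integrable_of_continuous {ν : Measure X} [IsFiniteMeasure ν] {f : X → ℂ}
    (hf : Continuous f) : Integrable f ν :=
  hf.integrable_of_hasCompactSupport (HasCompactSupport.of_compactSpace f)

variable {ν : Measure X} [IsFiniteMeasure ν] {P : X → Matrix (Fin N) (Fin N) ℂ} {a : ℝ}

omit [CompactSpace X] [BorelSpace X] [MeasurableSpace X] in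
theorem continuous_congr (hP : Continuous P) (G : Matrix (Fin N) (Fin N) ℂ) :
    Continuous fun x => G * P x * Gᴴ :=
  (continuous_const.matrix_mul hP).matrix_mul continuous_const

omit [CompactSpace X] [BorelSpace X] [MeasurableSpace X] in
theorem continuous_momentIntegrand {Y : Type*} [TopologicalSpace Y]
    {Q : Y → Matrix (Fin N) (Fin N) ℂ} (hQ : Continuous Q)
    (hpos : ∀ y, 0 < (Q y).trace.re) (a : ℝ) (j k : Fin N) :
    Continuous fun y => (((Q y).trace.re ^ a : ℝ) : ℂ) * Q y j k :=
  (Complex.continuous_ofReal.comp ((Complex.continuous_re.comp hQ.matrix_trace).rpow_const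
    fun y => Or.inl (hpos y).ne')).mul (hQ.matrix_elem j k)

/-- The factor `(Tr Q) ^ a` is unchanged when `Q` is conjugated by `U`, so `U` and `Uᴴ` come out of
the integral by linearity. -/
theorem momentIntegral_unitary_mul (hP : Continuous P) {U G : Matrix (Fin N) (Fin N) ℂ}
    (hU : U ∈ Matrix.unitaryGroup (Fin N) ℂ) (hpos : ∀ x, 0 < (G * P x * Gᴴ).trace.re) :
    momentIntegral ν P a (U * G) = U * momentIntegral ν P a G * Uᴴ := by
  have hint (l q : Fin N) : Integrable
      (fun x => (((G * P x * Gᴴ).trace.re ^ a : ℝ) : ℂ) * (G * P x * Gᴴ) l q) ν :=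
    integrable_of_continuous (continuous_momentIntegrand (continuous_congr hP G) hpos a l q)
  have hQ (x : X) : U * G * P x * (U * G)ᴴ = U * (G * P x * Gᴴ) * Uᴴ := by
    rw [Matrix.conjTranspose_mul]
    simp only [Matrix.mul_assoc]
  ext j k
  have htr (x : X) : (U * (G * P x * Gᴴ) * Uᴴ).trace = (G * P x * Gᴴ).trace := by
    rw [Matrix.trace_mul_cycle, conjTranspose_mul_self_of_unitary hU, Matrix.one_mul]
  have hexp (x : X) : (((G * P x * Gᴴ).trace.re ^ a : ℝ) : ℂ) *
      (U * (G * P x * Gᴴ) * Uᴴ) j k = ∑ q, (∑ l, U j l *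
        ((((G * P x * Gᴴ).trace.re ^ a : ℝ) : ℂ) * (G * P x * Gᴴ) l q)) * Uᴴ q k := by
    rw [Matrix.mul_apply, Finset.mul_sum]
    refine Finset.sum_congr rfl fun q _ => ?_
    rw [Matrix.mul_apply, Finset.sum_mul, Finset.sum_mul, Finset.mul_sum]
    exact Finset.sum_congr rfl fun l _ => by ring
  have hR : (U * momentIntegral ν P a G * Uᴴ) j k = ∑ q, (∑ l, U j l *
      ∫ x, (((G * P x * Gᴴ).trace.re ^ a : ℝ) : ℂ) * (G * P x * Gᴴ) l q ∂ν) * Uᴴ q k := by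
    rw [Matrix.mul_apply]
    refine Finset.sum_congr rfl fun q _ => ?_
    rw [Matrix.mul_apply]
    rfl
  rw [hR, momentIntegral, Matrix.of_apply]
  simp only [hQ, htr, hexp]
  rw [integral_finsetSum _ fun q _ =>
    (integrable_finsetSum _ fun l _ => (hint l q).const_mul _).mul_const _]
  refine Finset.sum_congr rfl fun q _ => ?_
  rw [integral_mul_const, integral_finsetSum _ fun l _ => (hint l q).const_mul _]
  congr 1
  exact Finset.sum_congr rfl fun l _ => integral_const_mul _ _

theorem continuous_momentIntegral_exp (hP : Continuous P)
    (hpos : ∀ G : Matrix (Fin N) (Fin N) ℂ, IsUnit G → ∀ x, 0 < (G * P x * Gᴴ).trace.re) :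
    Continuous fun B => momentIntegral ν P a (NormedSpace.exp B) := by
  refine continuous_matrix fun j k => ?_
  have : FirstCountableTopology (Matrix (Fin N) (Fin N) ℂ) :=
    inferInstanceAs (FirstCountableTopology (Fin N → Fin N → ℂ))
  have : LocallyCompactSpace (Matrix (Fin N) (Fin N) ℂ) :=
    inferInstanceAs (LocallyCompactSpace (Fin N → Fin N → ℂ))
  have hc : Continuous fun y : Matrix (Fin N) (Fin N) ℂ × X =>
      NormedSpace.exp y.1 * P y.2 * (NormedSpace.exp y.1)ᴴ :=
    ((continuous_matrix_exp.comp continuous_fst).matrix_mul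
      (hP.comp continuous_snd)).matrix_mul
        (continuous_matrix_exp.comp continuous_fst).matrix_conjTranspose
  have h := continuous_parametric_integral_of_continuous (μ := ν)
    (f := fun (B : Matrix (Fin N) (Fin N) ℂ) x =>
      (((NormedSpace.exp B * P x * (NormedSpace.exp B)ᴴ).trace.re ^ a : ℝ) : ℂ) *
        (NormedSpace.exp B * P x * (NormedSpace.exp B)ᴴ) j k)
    (continuous_momentIntegrand hc (fun y => hpos _ (isUnit_exp y.1) y.2) a j k)
    (isCompact_univ (X := X))
  simpa only [momentIntegral, Matrix.of_apply, Measure.restrict_univ] using h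

theorem differentiableAt_momentIntegral (hP : Continuous P)
    (hpos : ∀ G : Matrix (Fin N) (Fin N) ℂ, IsUnit G → ∀ x, 0 < (G * P x * Gᴴ).trace.re)
    (A : Matrix (Fin N) (Fin N) ℂ) {G : Matrix (Fin N) (Fin N) ℂ} (hG : IsUnit G) (j k : Fin N) :
    DifferentiableAt ℝ
      (fun t : ℝ => momentIntegral ν P a (NormedSpace.exp ((t : ℂ) • A) * G) j k) 0 := by
  set R : X → Matrix (Fin N) (Fin N) ℂ := fun x => G * P x * Gᴴ with hR
  have hRc : Continuous R := continuous_congr hP G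
  have hQ (t : ℝ) (x : X) : NormedSpace.exp ((t : ℂ) • A) * G * P x *
      (NormedSpace.exp ((t : ℂ) • A) * G)ᴴ = expCongr A (R x) t := by
    rw [expCongr, Matrix.conjTranspose_mul]
    simp only [hR, Matrix.mul_assoc]
  have hτ (t : ℝ) (x : X) : 0 < (expCongr A (R x) t).trace.re := by
    rw [← hQ]
    exact hpos _ ((isUnit_exp _).mul hG) x
  simp only [momentIntegral, Matrix.of_apply, hQ]
  have hcQ : Continuous fun y : ℝ × X => expCongr A (R y.2) y.1 :=
    continuous_expCongr A (hRc.comp continuous_snd) continuous_fst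
  have hcQ' : Continuous fun y : ℝ × X => expCongr A (A * R y.2 + R y.2 * Aᴴ) y.1 :=
    continuous_expCongr A (((continuous_const.matrix_mul (hRc.comp continuous_snd))).add
      ((hRc.comp continuous_snd).matrix_mul continuous_const)) continuous_fst
  let F' : ℝ → X → ℂ := fun t x =>
    (((expCongr A (A * R x + R x * Aᴴ) t).trace.re * a *
      (expCongr A (R x) t).trace.re ^ (a - 1) : ℝ) : ℂ) * expCongr A (R x) t j k +
    (((expCongr A (R x) t).trace.re ^ a : ℝ) : ℂ) * expCongr A (A * R x + R x * Aᴴ) t j k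
  have hF'c : Continuous fun y : ℝ × X => F' y.1 y.2 := by
    have hre := Complex.continuous_re.comp hcQ.matrix_trace
    have hre' := Complex.continuous_re.comp hcQ'.matrix_trace
    have hpow (b : ℝ) := hre.rpow_const (p := b) fun y => Or.inl (hτ y.1 y.2).ne'
    exact ((Complex.continuous_ofReal.comp ((hre'.mul continuous_const).mul (hpow (a - 1)))).mul
      (hcQ.matrix_elem j k)).add
      ((Complex.continuous_ofReal.comp (hpow a)).mul (hcQ'.matrix_elem j k))
  -- Joint continuity on the compact `[-1, 1] × X` gives a constant dominating function for
  -- differentiation under the integral.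
  obtain ⟨C, hC⟩ := ((isCompact_Icc (a := (-1 : ℝ)) (b := 1)).prod
    (isCompact_univ (X := X))).bddAbove_image hF'c.norm.continuousOn
  have hFc (t : ℝ) : Continuous fun x =>
      (((expCongr A (R x) t).trace.re ^ a : ℝ) : ℂ) * expCongr A (R x) t j k :=
    continuous_momentIntegrand (continuous_expCongr A hRc continuous_const) (hτ t) a j k
  have key := hasDerivAt_integral_of_dominated_loc_of_deriv_le (μ := ν) (𝕜 := ℝ) (x₀ := (0 : ℝ))
    (F := fun t x => (((expCongr A (R x) t).trace.re ^ a : ℝ) : ℂ) * expCongr A (R x) t j k)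
    (F' := F') (bound := fun _ => C) (Icc_mem_nhds (a := (-1 : ℝ)) (b := 1) (by norm_num)
      (by norm_num))
    (Filter.Eventually.of_forall fun t => (integrable_of_continuous (hFc t)).1)
    (integrable_of_continuous (hFc 0))
    (integrable_of_continuous (hF'c.comp (continuous_const.prodMk continuous_id))).1
    (Filter.Eventually.of_forall fun x t ht => hC ⟨(t, x), ⟨ht, Set.mem_univ _⟩, rfl⟩)
    (integrable_const C)
    (Filter.Eventually.of_forall fun x t _ => ?_)
  · exact key.2.differentiableAt
  · have h1 := (hasDerivAt_expCongr_trace A (R x) t).rpow_const (p := a) (Or.inl (hτ t x).ne')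
    exact h1.ofReal_comp.fun_mul (hasDerivAt_expCongr_entry A (R x) t j k)

end MomentIntegral

/-! ### The moment map along an orbit of matrices. -/

section MomentMap

variable {n : ℕ} {X : Type*} [TopologicalSpace X] [T2Space X] [CompactSpace X]
  [ChartedSpace (Fin n → ℂ) X] [IsManifold 𝓘(ℂ, Fin n → ℂ) ω X] [MeasurableSpace X] [BorelSpace X]
  {p N : ℕ}

/-- The metric contributes `Q / Tr Q` and the volume form `(Tr Q) ^ (-1/p)`. The trace of the
resulting integrand is the volume density itself, so subtracting `Vol / N` times the identity is
exactly the traceless projection. -/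
theorem momentMap_act (hp : 0 < p) {s : Fin N → H0 n X p} (hs : ∀ x, ∃ j, s j x ≠ 0)
    {G : Matrix (Fin N) (Fin N) ℂ} (hG : IsUnit G) :
    momentMap (act G s) =
      traceless (momentIntegral (volumeForm s) (fsMatrix s) (-(1 / p) - 1) G) := by
  have := isFiniteMeasure_volumeForm hp hs
  have hτ (x : X) : 0 < (G * fsMatrix s x * Gᴴ).trace.re := traceRatio_pos (hs x) hG
  have hpow (x : X) : volumeRatio G s x / traceRatio G s x =
      (G * fsMatrix s x * Gᴴ).trace.re ^ (-(1 / p) - 1 : ℝ) := by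
    rw [Real.rpow_sub_one (hτ x).ne']
    rfl
  have hM : Matrix.of (fun j k => ∫ x, fsInner (act G s) x (act G s j x) (act G s k x)
      ∂(volumeForm (act G s))) =
      momentIntegral (volumeForm s) (fsMatrix s) (-(1 / p) - 1) G := by
    ext j k
    rw [momentIntegral, Matrix.of_apply, Matrix.of_apply, integral_volumeForm_act hs hG]
    refine integral_congr_ae (Filter.Eventually.of_forall fun x => ?_)
    have h := fsMatrix_act (hs x) hG j k
    rw [fsMatrix, Matrix.of_apply] at h
    simp only []
    rw [h, ← hpow, Complex.ofReal_div]
    ring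
  have hvol : (((volumeForm (act G s)).real Set.univ : ℝ) : ℂ) =
      (momentIntegral (volumeForm s) (fsMatrix s) (-(1 / p) - 1) G).trace := by
    have h1 : (((volumeForm (act G s)).real Set.univ : ℝ) : ℂ) =
        ∫ _x, (1 : ℂ) ∂(volumeForm (act G s)) := by
      rw [integral_const, Complex.real_smul, mul_one]
    rw [h1, integral_volumeForm_act hs hG, Matrix.trace]
    simp only [Matrix.diag_apply, momentIntegral, Matrix.of_apply]
    rw [← integral_finsetSum _ fun j _ => integrable_of_continuous
      (continuous_momentIntegrand (continuous_congr (continuous_fsMatrix hs) G) hτ _ j j)]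
    refine integral_congr_ae (Filter.Eventually.of_forall fun x => ?_)
    simp only []
    rw [← Finset.mul_sum, ← hpow]
    have htr : ∑ j, (G * fsMatrix s x * Gᴴ) j j = ((traceRatio G s x : ℝ) : ℂ) := by
      have hH := Matrix.isHermitian_mul_mul_conjTranspose G (fsMatrix_isHermitian (hs x))
      have h : (starRingEnd ℂ) (G * fsMatrix s x * Gᴴ).trace = (G * fsMatrix s x * Gᴴ).trace := by
        rw [← Complex.star_def, ← Matrix.trace_conjTranspose, hH.eq]
      exact (Complex.conj_eq_iff_re.1 h).symm
    have hne : (traceRatio G s x : ℂ) ≠ 0 := Complex.ofReal_ne_zero.2 (hτ x).ne'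
    rw [htr, Complex.ofReal_div, div_mul_cancel₀ _ hne, mul_one]
  rw [momentMap, traceless, hM, ← hvol, Complex.ofReal_div, Complex.ofReal_natCast]

omit [T2Space X] [CompactSpace X] [MeasurableSpace X] [BorelSpace X] in
theorem exists_basis_ne_zero (hgen : ∀ x : X, ∃ u : H0 n X p, u x ≠ 0)
    (s : Module.Basis (Fin N) ℂ (H0 n X p)) (x : X) : ∃ j, s j x ≠ 0 := by
  by_contra! h
  obtain ⟨u, hu⟩ := hgen x
  apply hu
  rw [← s.sum_repr u, sum_smul_apply]
  exact Finset.sum_eq_zero fun k _ => by rw [h k, smul_zero]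

end MomentMap

end

end Anticanonical

/-! ### The proposition. -/

open Anticanonical
theorem proposition3p9 {n : ℕ} {X : Type*} [TopologicalSpace X] [T2Space X] [CompactSpace X]
    [ChartedSpace (Fin n → ℂ) X] [IsManifold 𝓘(ℂ, Fin n → ℂ) ω X]
    [MeasurableSpace X] [BorelSpace X]
    -- `L^p = K_X^{-p}` with `p ≥ 1`, for which the Kodaira map is well defined
    {p : ℕ} (hp : 0 < p) (hgen : ∀ x : X, ∃ u : H0 n X p, u x ≠ 0)
    -- a basis of `H^0(X, L^p)`, so that `N = dim H^0(X, L^p)`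
    {N : ℕ} (s : Module.Basis (Fin N) ℂ (H0 n X p))
    {lam δ : ℝ} (hlam : 0 < lam) (hδ : 0 < δ)
    (h1 : lam * trNorm (momentMap s) < δ)
    (h2 : ∀ A B : Matrix (Fin N) (Fin N) ℂ, A.IsHermitian → A.trace = 0 → B.IsHermitian →
      trNorm B ≤ δ →
      trNorm A ^ 2 ≤ lam * (A * dMomentMap (act (NormedSpace.exp B) s) A).trace.re) :
    ∃ B : Matrix (Fin N) (Fin N) ℂ, B.IsHermitian ∧ trNorm B ≤ δ ∧
      momentMap (act (NormedSpace.exp B) s) = 0 := by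
  have hs := exists_basis_ne_zero hgen s
  have := isFiniteMeasure_volumeForm hp hs
  have hP := continuous_fsMatrix hs
  have hpos (G : Matrix (Fin N) (Fin N) ℂ) (hG : IsUnit G) (x : X) :
      0 < (G * fsMatrix s x * Gᴴ).trace.re := traceRatio_pos (hs x) hG
  refine exists_zero_of_derivative_ge (m := fun G => momentMap (act G s))
    (D := fun G A => dMomentMap (act G s) A) ?_ ?_ ?_ ?_ ?_ hlam hδ ?_ h2
  · intro U hU G hG
    have hUu : IsUnit U := IsUnit.of_mul_eq_one _ (self_mul_conjTranspose_of_unitary hU)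
    rw [momentMap_act hp hs (hUu.mul hG), momentMap_act hp hs hG,
      momentIntegral_unitary_mul hP hU (hpos G hG), traceless_unitary_conj hU]
  · intro G hG
    simp only [momentMap_act hp hs hG]
    exact traceless_isHermitian
      (momentIntegral_isHermitian _ (fun x => fsMatrix_isHermitian (hs x)) _ G)
  · intro G hG
    simp only [momentMap_act hp hs hG, trace_traceless]
  · simp only [momentMap_act hp hs (isUnit_exp _)]
    have h := continuous_momentIntegral_exp (ν := volumeForm (s : Fin N → H0 n X p))
      (a := -(1 / p) - 1) hP hpos
    exact h.sub ((h.matrix_trace.div_const _).smul continuous_const)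
  · intro A G hG j k
    have hfun (t : ℝ) : momentMap (act (NormedSpace.exp ((t : ℂ) • A)) (act G s)) =
        traceless (momentIntegral (volumeForm s) (fsMatrix s) (-(1 / p) - 1)
          (NormedSpace.exp ((t : ℂ) • A) * G)) := by
      rw [← act_mul, momentMap_act hp hs ((isUnit_exp _).mul hG)]
    simp only [act_mul, dMomentMap, Matrix.of_apply]
    -- `dMomentMap` is built from `deriv`, which is `0` by default; true differentiability is what
    -- gives the hypothesis on it its content.
    refine DifferentiableAt.hasDerivAt ?_
    simp only [hfun]
    have hd (l q : Fin N) := differentiableAt_momentIntegral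
      (ν := volumeForm (s : Fin N → H0 n X p)) (a := -(1 / p) - 1) hP hpos A hG l q
    simp only [traceless, Matrix.sub_apply, Matrix.smul_apply, smul_eq_mul, Matrix.trace,
      Matrix.diag_apply]
    exact (hd j k).fun_sub
      (((DifferentiableAt.fun_sum fun l _ => hd l l).div_const _).mul_const _)
  · simpa only [act_one] using h1
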